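/- Let $\mathbb F$ be a field of characteristic $0$, let $p_1\ge p_2\ge\dots\ge p_r>0$ be a partition of $N\ge1$, and let $r_1$ be the multiplicity of $p_1$. Let $\mathcal J=\{(i,h):1\le i\le r,\ 1\le h\le p_i\}$, let $V=\mathbb F^N$ have basis $\{e_{ih}\}_{(i,h)\in\mathcal J}$, and let $\mathfrak g=\mathfrak{gl}(V)=\mathfrak{gl}_N$ with trace form $(a|b)=\operatorname{tr}(ab)$ and elementary matrices $E_{ab}$, $a,b\in\mathcal J$. Let $f=\sum_{h<p_i}E_{(i,h+1),(i,h)}$, let $x$ be the diagonal matrix with eigenvalue $\tfrac12(p_i+1-2h)$ on $e_{ih}$, let $\mathfrak g_k=\{a\in\mathfrak g:[x,a]=ka\}$, $k\in\frac12\mathbb Z$, and let $d=p_1-1$ be the largest eigenvalue of $\operatorname{ad}x$. Write $\mathfrak g_{\ge\frac12}=\bigoplus_{k\ge\frac12}\mathfrak g_k$, $\mathfrak g_{\le\frac12}=\bigoplus_{k\le\frac12}\mathfrak g_k$. For a subspace $\mathfrak a\subset\mathfrak g$ let $\mathcal V(\mathfrak a)=S(\mathbb F[\partial]\mathfrak a)$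 be the algebra of differential polynomials over $\mathfrak a$. For $S\in\mathfrak g_d$ and $\epsilon\in\mathbb F$, let $\{\cdot\,_\lambda\,\cdot\}_\epsilon$ be the $\lambda$-bracket on $\mathcal V(\mathfrak g)$ given on generators by $\{a_\lambda b\}_\epsilon=[a,b]+(a|b)\lambda+\epsilon(S|[a,b])$, $a,b\in\mathfrak g$, and extended by sesquilinearity and the Leibniz rules. Let $\rho:\mathcal V(\mathfrak g)\to\mathcal V(\mathfrak g_{\le\frac12})$ be the differential algebra homomorphism with $\rho(a)=\pi_{\le\frac12}(a)+(f|a)$ for $a\in\mathfrak g$, where $\pi_{\le\frac12}$ is the projection onto $\mathfrak g_{\le\frac12}$ with kernel $\mathfrak g_{\ge1}$. The classical affine $\mathcal W$-algebra is $$\mathcal W=\mathcal W(\mathfrak g,f)=\{w\in\mathcal V(\mathfrak g_{\le\frac12}):\ \rho\{a_\lambda w\}_\epsilon=0\ \text{ for all } a\in\mathfrak g_{\ge\frac12}\}$$ (which does not depend on $S\in\mathfrak g_d$ and $\epsilon$). For a unital associative algebra $R$ and matrices $A\in\mathrm{Mat}_{n\times n}R$, $I\in\mathrm{Mat}_{n\times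 m}R$, $J\in\mathrm{Mat}_{m\times n}R$, the generalized quasideterminant is $|A|_{IJ}=(JA^{-1}I)^{-1}$; it is said to exist if $A$ and $JA^{-1}I$ are invertible. For a differential algebra $\mathcal A$, let $\mathcal A((\partial^{-1}))$ be the algebra of pseudodifferential operators $\sum_{n\le n_0}a_n\partial^n$, $a_n\in\mathcal A$. Let $I_1=\sum_{i=1}^{r_1}E_{(i1),i}\in\mathrm{Mat}_{N\times r_1}\mathbb F$, $J_1=\sum_{i=1}^{r_1}E_{i,(ip_1)}\in\mathrm{Mat}_{r_1\times N}\mathbb F$, let $Q$ be the $N\times N$ matrix whose entry in position $(a,b)$ is $E_{ba}$ regarded as an element of $\mathcal V(\mathfrak g)$, and put $$L_1(\partial)=|\mathbb 1_N\partial+\rho(Q)|_{I_1J_1}.$$ Then: (a) The quasideterminant $L_1(\partial)$ exists over $\mathcal V(\mathfrak g_{\le\frac12})((\partial^{-1}))$, and all entries of all its coefficients lie in $\mathcal W(\mathfrak g,f)$. (b) Let $\mathcal K(\mathfrak g_{\le\frac12})$ be the field of fractions of $\mathcal V(\mathfrak g_{\le\frac12})$. Let $S=\sum_{i,j=1}^{r_1}s_{ij}E_{(i1),(jp_1)}$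 be a nonzero element of $\mathfrak g_d$, let $\bar S=(s_{ij})\in\mathrm{Mat}_{r_1\times r_1}\mathbb F$ have rank $\bar r$, and let $\bar S=\bar I\bar J$ be its canonical factorization, where $\bar I\in\mathrm{Mat}_{r_1\times\bar r}\mathbb F$ and $\bar J\in\mathrm{Mat}_{\bar r\times r_1}\mathbb F$ are the matrices, in any basis of $\operatorname{im}\bar S$, of the inclusion $\operatorname{im}\bar S\hookrightarrow\mathbb F^{r_1}$ and of the surjection $\mathbb F^{r_1}\twoheadrightarrow\operatorname{im}\bar S$, $X\mapsto\bar SX$. Then the quasideterminant $L(\partial)=|L_1(\partial)|_{\bar I\bar J}$ exists over $\mathcal K(\mathfrak g_{\le\frac12})((\partial^{-1}))$, and all entries of all its coefficients lie in the field of fractions of $\mathcal W(\mathfrak g,f)$, regarded as a subfield of $\mathcal K(\mathfrak g_{\le\frac12})$. -/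

import Mathlib

section PseudoDifferential

variable {V : Type*} [CommRing V]

/-- Functions `n ↦ a n` on `ℤ` vanishing for all large `n`. -/
def psiDOSubgroup (V : Type*) [CommRing V] : AddSubgroup (ℤ → V) where
  carrier := {a | ∃ N : ℤ, ∀ n, N < n → a n = 0}
  zero_mem' := ⟨0, fun _ _ => rfl⟩
  add_mem' := by
    rintro a b ⟨N, hN⟩ ⟨M, hM⟩
    refine ⟨max N M, fun n hn => ?_⟩
    simp [hN n (lt_of_le_of_lt (le_max_left _ _) hn), hM n (lt_of_le_of_lt (le_max_right _ _) hn)]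
  neg_mem' := by
    rintro a ⟨N, hN⟩
    exact ⟨N, fun n hn => by simp [hN n hn]⟩

/-- The pseudodifferential operators `V((∂⁻¹))`: formal sums `∑ₙ aₙ ∂ⁿ` over `n ∈ ℤ` with
coefficients written on the left and `aₙ = 0` for all large `n`. -/
def PsiDO (V : Type*) [CommRing V] : Type _ := psiDOSubgroup V

namespace PsiDO

instance : AddCommGroup (PsiDO V) := inferInstanceAs (AddCommGroup (psiDOSubgroup V))

/-- The coefficient of `∂ⁿ`. -/
def coeff (a : PsiDO V) (n : ℤ) : V := a.1 n

@[ext] theorem ext {a b : PsiDO V} (h : ∀ n, a.coeff n = b.coeff n) : a = b :=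
  Subtype.ext (funext h)

@[simp] theorem coeff_add (a b : PsiDO V) (n : ℤ) :
    (a + b).coeff n = a.coeff n + b.coeff n := rfl

@[simp] theorem coeff_zero (n : ℤ) : (0 : PsiDO V).coeff n = 0 := rfl

theorem exists_bound (a : PsiDO V) : ∃ N : ℤ, ∀ n, N < n → a.coeff n = 0 := a.2

/-- The operator `v ∂ᵐ`. -/
def monomial (m : ℤ) (v : V) : PsiDO V :=
  ⟨fun n => if n = m then v else 0, m, fun _ hn => if_neg hn.ne'⟩

theorem coeff_monomial (m n : ℤ) (v : V) :
    (monomial m v).coeff n = if n = m then v else 0 := rfl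

/-- An element of `V` as an operator of order zero. -/
def const (v : V) : PsiDO V := monomial 0 v

/-- The operator `∂`. -/
def del : PsiDO V := monomial 1 1

/-- Application of a ring homomorphism to all coefficients. -/
def map {V' : Type*} [CommRing V'] (φ : V →+* V') (a : PsiDO V) : PsiDO V' :=
  ⟨fun n => φ (a.coeff n), by
    obtain ⟨N, hN⟩ := a.exists_bound
    exact ⟨N, fun n hn => by simp only [hN n hn, map_zero]⟩⟩

@[simp] theorem coeff_map {V' : Type*} [CommRing V'] (φ : V →+* V') (a : PsiDO V) (n : ℤ) :
    (a.map φ).coeff n = φ (a.coeff n) := rfl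

instance : One (PsiDO V) := ⟨const 1⟩

theorem common_bound (a b : PsiDO V) :
    ∃ N : ℤ, (∀ m, N < m → a.coeff m = 0) ∧ (∀ m, N < m → b.coeff m = 0) := by
  obtain ⟨A, hA⟩ := a.exists_bound
  obtain ⟨B, hB⟩ := b.exists_bound
  exact ⟨max A B, fun m hm => hA m (by lia), fun m hm => hB m (by lia)⟩

/-- Reindexing of a sum over the integers of an interval. -/
theorem sum_Icc_ite {lo hi L H : ℤ} (hL : L ≤ lo) (hH : hi ≤ H) (F : ℤ → V) :
    (∑ s ∈ Finset.Icc L H, if lo ≤ s ∧ s ≤ hi then F s else 0) =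
      if lo ≤ hi then
        ∑ jk ∈ Finset.HasAntidiagonal.antidiagonal (hi - lo).toNat, F (hi - jk.1) else 0 := by
  rw [← Finset.sum_filter]
  split_ifs with h
  · symm
    refine Finset.sum_bij (fun jk _ => hi - jk.1) ?_ ?_ ?_ ?_
    · intro jk hjk
      have := Finset.HasAntidiagonal.mem_antidiagonal.mp hjk
      simp only [Finset.mem_filter, Finset.mem_Icc]
      lia
    · intro jk hjk jk' hjk' e
      have := Finset.HasAntidiagonal.mem_antidiagonal.mp hjk
      have := Finset.HasAntidiagonal.mem_antidiagonal.mp hjk'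
      ext <;> lia
    · intro s hs
      simp only [Finset.mem_filter, Finset.mem_Icc] at hs
      refine ⟨((hi - s).toNat, (s - lo).toNat), ?_, ?_⟩
      · rw [Finset.HasAntidiagonal.mem_antidiagonal]; lia
      · simp only; lia
    · intro _ _; rfl
  · refine Finset.sum_eq_zero fun s hs => ?_
    simp only [Finset.mem_filter, Finset.mem_Icc] at hs
    lia

variable [Differential V]

/-- The `k`-th iterate of the derivation. -/
def iterDeriv (k : ℕ) : Module.End ℤ V := (Differential.deriv : Derivation ℤ V V).toLinearMap ^ k

theorem iterDeriv_zero (a : V) : iterDeriv 0 a = a := rfl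

theorem iterDeriv_succ (k : ℕ) (a : V) : iterDeriv (k + 1) a = Differential.deriv (iterDeriv k a) := by
  rw [iterDeriv, pow_succ']; rfl

theorem iterDeriv_add (k l : ℕ) (a : V) : iterDeriv (k + l) a = iterDeriv k (iterDeriv l a) := by
  rw [iterDeriv, pow_add]; rfl

theorem iterDeriv_one_pos {k : ℕ} (hk : k ≠ 0) : iterDeriv k (1 : V) = 0 := by
  obtain ⟨k, rfl⟩ := Nat.exists_eq_succ_of_ne_zero hk
  rw [Nat.succ_eq_add_one, iterDeriv_add, show iterDeriv 1 (1 : V) = 0 from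
    Derivation.map_one_eq_zero _, map_zero]

open Finset in
theorem iterDeriv_mul (n : ℕ) (a b : V) :
    iterDeriv n (a * b) =
      ∑ ij ∈ Finset.HasAntidiagonal.antidiagonal n, n.choose ij.1 • (iterDeriv ij.1 a * iterDeriv ij.2 b) := by
  induction n with
  | zero => simp [iterDeriv_zero]
  | succ n ih =>
    rw [sum_antidiagonal_choose_succ_nsmul
      (fun i j => iterDeriv i a * iterDeriv j b), iterDeriv_succ, ih, map_sum,
      ← sum_add_distrib]
    refine sum_congr rfl fun ij hij => ?_
    rw [map_nsmul, Derivation.leibniz, iterDeriv_succ, iterDeriv_succ,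
      ← Nat.choose_symm_of_eq_add (Finset.HasAntidiagonal.mem_antidiagonal.mp hij).symm]
    simp only [smul_eq_mul, nsmul_eq_mul]
    ring

/-- The summand of the `n`-th coefficient of a product coming from `∂ⁱ` and `∂ᵗ`. -/
def mulTerm (a b : ℤ → V) (n i t : ℤ) : V :=
  if n ≤ i + t then
    Ring.choose i (i + t - n).toNat • (a i * iterDeriv (i + t - n).toNat (b t)) else 0

/-- The `n`-th coefficient of the product determined by
`∂ⁱ ∘ b = ∑ₖ (i choose k) b⁽ᵏ⁾ ∂ⁱ⁻ᵏ` for `i ∈ ℤ`. -/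
noncomputable def mulCoeff (a b : ℤ → V) (n : ℤ) : V :=
  ∑ᶠ x : ℤ × ℕ, Ring.choose x.1 x.2 • (a x.1 * iterDeriv x.2 (b (n - x.1 + x.2)))

theorem mulCoeff_eq {a b : ℤ → V} {n A B lo lo' A' B' : ℤ}
    (ha : ∀ m, A < m → a m = 0) (hb : ∀ m, B < m → b m = 0)
    (hA : A ≤ A') (hB : B ≤ B') (h1 : lo ≤ n - B) (h2 : lo' ≤ n - A) :
    mulCoeff a b n =
      ∑ i ∈ Finset.Icc lo A', ∑ t ∈ Finset.Icc lo' B', mulTerm a b n i t := by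
  classical
  rw [← Finset.sum_product', mulCoeff]
  rw [finsum_eq_sum_of_support_subset (s := ((Finset.Icc lo A' ×ˢ Finset.Icc lo' B').filter
    (fun x => n ≤ x.1 + x.2)).image (fun x : ℤ × ℤ => (x.1, (x.1 + x.2 - n).toNat)))]
  · rw [Finset.sum_image, Finset.sum_filter]
    · refine Finset.sum_congr rfl fun x _ => ?_
      rw [mulTerm]
      split_ifs with h
      · simp only
        rw [show n - x.1 + ((x.1 + x.2 - n).toNat : ℤ) = x.2 by
          rw [Int.toNat_of_nonneg (by lia)]; ring]
      · rfl
    · rintro ⟨i, t⟩ h ⟨i', t'⟩ h' e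
      simp only [Finset.coe_filter, Set.mem_ofPred_eq, Prod.mk.injEq] at h h' e ⊢
      lia
  · rintro ⟨i, k⟩ h
    rw [Function.mem_support] at h
    simp only [Finset.coe_image, Set.mem_image, Finset.coe_filter, Finset.mem_product,
      Finset.mem_Icc, Set.mem_ofPred_eq, Prod.mk.injEq]
    have hi : i ≤ A := by
      by_contra hc
      exact h (by simp [ha i (by lia)])
    have ht : n - i + k ≤ B := by
      by_contra hc
      exact h (by simp [hb (n - i + k) (by lia)])
    exact ⟨(i, n - i + k), by simp only; lia, rfl, by simp only; lia⟩

noncomputable instance : Mul (PsiDO V) where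
  mul a b := ⟨mulCoeff a.coeff b.coeff, by
    obtain ⟨A, hA⟩ := a.exists_bound
    obtain ⟨B, hB⟩ := b.exists_bound
    refine ⟨A + B, fun n hn => ?_⟩
    rw [mulCoeff_eq (lo := n - B) (lo' := n - A) hA hB le_rfl le_rfl le_rfl le_rfl]
    rw [Finset.Icc_eq_empty (by lia), Finset.sum_empty]⟩

/-- `(∑ᵢ aᵢ ∂ⁱ)(∑ₜ bₜ ∂ᵗ) = ∑ (i choose k) aᵢ bₜ⁽ᵏ⁾ ∂ⁱ⁺ᵗ⁻ᵏ`. -/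
theorem coeff_mul (a b : PsiDO V) (n : ℤ) : (a * b).coeff n =
    ∑ᶠ x : ℤ × ℕ,
      Ring.choose x.1 x.2 • (a.coeff x.1 * iterDeriv x.2 (b.coeff (n - x.1 + x.2))) := rfl

theorem coeff_mul_eq {a b : PsiDO V} {n A B lo lo' A' B' : ℤ}
    (ha : ∀ m, A < m → a.coeff m = 0) (hb : ∀ m, B < m → b.coeff m = 0)
    (hA : A ≤ A') (hB : B ≤ B') (h1 : lo ≤ n - B) (h2 : lo' ≤ n - A) :
    (a * b).coeff n =
      ∑ i ∈ Finset.Icc lo A', ∑ t ∈ Finset.Icc lo' B', mulTerm a.coeff b.coeff n i t :=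
  mulCoeff_eq ha hb hA hB h1 h2

theorem mul_bound {a b : PsiDO V} {A B : ℤ}
    (ha : ∀ m, A < m → a.coeff m = 0) (hb : ∀ m, B < m → b.coeff m = 0) :
    ∀ m, A + B < m → (a * b).coeff m = 0 := by
  intro n hn
  rw [coeff_mul_eq (lo := n - B) (lo' := n - A) ha hb le_rfl le_rfl le_rfl le_rfl,
    Finset.Icc_eq_empty (by lia), Finset.sum_empty]

protected theorem add_mul (a b c : PsiDO V) : (a + b) * c = a * c + b * c := by
  obtain ⟨A, ha, hb⟩ := common_bound a b
  obtain ⟨C, hc⟩ := c.exists_bound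
  ext n
  rw [coeff_add, coeff_mul_eq (lo := n - C) (lo' := n - A) (A := A) (B := C)
      (fun m hm => by simp [ha m hm, hb m hm]) hc le_rfl le_rfl le_rfl le_rfl,
    coeff_mul_eq (lo := n - C) (lo' := n - A) ha hc le_rfl le_rfl le_rfl le_rfl,
    coeff_mul_eq (lo := n - C) (lo' := n - A) hb hc le_rfl le_rfl le_rfl le_rfl]
  simp only [← Finset.sum_add_distrib]
  refine Finset.sum_congr rfl fun i _ => Finset.sum_congr rfl fun t _ => ?_
  simp only [mulTerm, coeff_add]
  split_ifs
  · simp only [zsmul_eq_mul]; ring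
  · simp

protected theorem mul_add (a b c : PsiDO V) : a * (b + c) = a * b + a * c := by
  obtain ⟨B, hb, hc⟩ := common_bound b c
  obtain ⟨A, ha⟩ := a.exists_bound
  ext n
  rw [coeff_add, coeff_mul_eq (lo := n - B) (lo' := n - A) (A := A) (B := B) ha
      (fun m hm => by simp [hb m hm, hc m hm]) le_rfl le_rfl le_rfl le_rfl,
    coeff_mul_eq (lo := n - B) (lo' := n - A) ha hb le_rfl le_rfl le_rfl le_rfl,
    coeff_mul_eq (lo := n - B) (lo' := n - A) ha hc le_rfl le_rfl le_rfl le_rfl]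
  simp only [← Finset.sum_add_distrib]
  refine Finset.sum_congr rfl fun i _ => Finset.sum_congr rfl fun t _ => ?_
  simp only [mulTerm, coeff_add, map_add]
  split_ifs
  · simp only [zsmul_eq_mul]; ring
  · simp

theorem const_mul_coeff (v : V) (a : PsiDO V) (n : ℤ) :
    (const v * a).coeff n = v * a.coeff n := by
  rw [coeff_mul, finsum_eq_single _ ((0 : ℤ), (0 : ℕ))]
  · simp [const, coeff_monomial, iterDeriv_zero]
  · rintro ⟨i, k⟩ h
    by_cases hi : i = 0
    · subst hi
      have hk : k ≠ 0 := by rintro rfl; exact h rfl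
      simp [Ring.choose_zero_pos ℤ (Nat.pos_of_ne_zero hk)]
    · simp [const, coeff_monomial, hi]

protected theorem one_mul (a : PsiDO V) : 1 * a = a := by
  ext n
  rw [show (1 : PsiDO V) = const 1 from rfl, const_mul_coeff, one_mul]

protected theorem mul_one (a : PsiDO V) : a * 1 = a := by
  ext n
  rw [show (1 : PsiDO V) = const 1 from rfl, coeff_mul, finsum_eq_single _ ((n : ℤ), (0 : ℕ))]
  · simp [const, coeff_monomial, iterDeriv_zero]
  · rintro ⟨i, k⟩ h
    simp only [const, coeff_monomial]
    split_ifs with hi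
    · have hk : k ≠ 0 := by
        rintro rfl
        exact h (by simp only [Prod.mk.injEq, and_true]; simp at hi; lia)
      simp [iterDeriv_one_pos hk]
    · simp

protected theorem zero_mul (a : PsiDO V) : 0 * a = 0 := by
  have h := PsiDO.add_mul 0 0 a
  rw [add_zero] at h
  exact left_eq_add.mp h

protected theorem mul_zero (a : PsiDO V) : a * 0 = 0 := by
  have h := PsiDO.mul_add a 0 0
  rw [add_zero] at h
  exact left_eq_add.mp h

open Finset in
theorem assoc_aux (i t : ℤ) (D : ℕ) (b c : V) :
    ∑ jk ∈ Finset.HasAntidiagonal.antidiagonal D, (Ring.choose (i + t - jk.1) jk.2 * Ring.choose i jk.1) •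
        (iterDeriv jk.1 b * iterDeriv jk.2 c) =
      ∑ lm ∈ Finset.HasAntidiagonal.antidiagonal D, (Ring.choose t lm.1 * Ring.choose i lm.2) •
        iterDeriv lm.2 (b * iterDeriv lm.1 c) := by
  have hL : ∀ jk ∈ Finset.HasAntidiagonal.antidiagonal D, (Ring.choose (i + t - jk.1) jk.2 * Ring.choose i jk.1) •
        (iterDeriv jk.1 b * iterDeriv jk.2 c) =
      ∑ lq ∈ Finset.HasAntidiagonal.antidiagonal jk.2, (Ring.choose i jk.1 * (Ring.choose (i - jk.1) lq.2 *
        Ring.choose t lq.1)) • (iterDeriv jk.1 b * iterDeriv (lq.1 + lq.2) c) := by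
    intro jk _
    rw [show i + t - (jk.1 : ℤ) = t + (i - jk.1) by ring,
      Ring.add_choose_eq jk.2 (Commute.all _ _), sum_mul, sum_smul]
    refine sum_congr rfl fun lq hlq => ?_
    rw [Finset.HasAntidiagonal.mem_antidiagonal.mp hlq]
    congr 1
    ring
  have hR : ∀ lm ∈ Finset.HasAntidiagonal.antidiagonal D, (Ring.choose t lm.1 * Ring.choose i lm.2) •
        iterDeriv lm.2 (b * iterDeriv lm.1 c) =
      ∑ jq ∈ Finset.HasAntidiagonal.antidiagonal lm.2, (Ring.choose i jq.1 * (Ring.choose (i - jq.1) jq.2 *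
        Ring.choose t lm.1)) • (iterDeriv jq.1 b * iterDeriv (lm.1 + jq.2) c) := by
    intro lm _
    rw [iterDeriv_mul, smul_sum]
    refine sum_congr rfl fun jq hjq => ?_
    have h := Finset.HasAntidiagonal.mem_antidiagonal.mp hjq
    have h2 := Ring.choose_smul_choose i (n := lm.2) (k := jq.1) (by lia)
    rw [show lm.2 - jq.1 = jq.2 by lia, nsmul_eq_mul] at h2
    rw [← iterDeriv_add, add_comm jq.2 lm.1, ← natCast_zsmul, smul_smul,
      ← mul_assoc (Ring.choose i jq.1), ← h2]
    congr 1
    ring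
  rw [sum_congr rfl hL, sum_congr rfl hR, sum_sigma', sum_sigma']
  refine sum_bij' (fun x _ => ⟨(x.2.1, x.1.1 + x.2.2), (x.1.1, x.2.2)⟩)
    (fun x _ => ⟨(x.2.1, x.1.1 + x.2.2), (x.1.1, x.2.2)⟩) ?_ ?_ ?_ ?_ ?_
  all_goals
    rintro ⟨⟨j, k⟩, ⟨l, q⟩⟩ h
    simp only [mem_sigma, Finset.HasAntidiagonal.mem_antidiagonal] at h ⊢
  · lia
  · lia
  · obtain ⟨h1, rfl⟩ := h; rfl
  · obtain ⟨h1, rfl⟩ := h; rfl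
  
protected theorem mul_assoc (a b c : PsiDO V) : a * b * c = a * (b * c) := by
  obtain ⟨A, ha⟩ := a.exists_bound
  obtain ⟨B, hb⟩ := b.exists_bound
  obtain ⟨C, hc⟩ := c.exists_bound
  ext n
  rw [coeff_mul_eq (lo := n - C) (lo' := n - A - B) (mul_bound ha hb) hc
      le_rfl le_rfl le_rfl (by lia),
    coeff_mul_eq (lo := n - B - C) (lo' := n - A) ha (mul_bound hb hc)
      le_rfl le_rfl (by lia) le_rfl]
  have key : ∀ i t u : ℤ, i ≤ A → t ≤ B → u ≤ C →
      (∑ s ∈ Finset.Icc (n - C) (A + B), if n - u ≤ s ∧ s ≤ i + t then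
        Ring.choose s (s + u - n).toNat • ((Ring.choose i (i + t - s).toNat •
          (a.coeff i * iterDeriv (i + t - s).toNat (b.coeff t))) *
            iterDeriv (s + u - n).toNat (c.coeff u)) else 0) =
      ∑ v ∈ Finset.Icc (n - A) (B + C), if n - i ≤ v ∧ v ≤ t + u then
        Ring.choose i (i + v - n).toNat • (a.coeff i * iterDeriv (i + v - n).toNat
          (Ring.choose t (t + u - v).toNat •
            (b.coeff t * iterDeriv (t + u - v).toNat (c.coeff u)))) else 0 := by
    intro i t u hi ht hu
    rw [sum_Icc_ite (by lia) (by lia), sum_Icc_ite (by lia) (by lia)]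
    by_cases h : n ≤ i + t + u
    · rw [if_pos (by lia), if_pos (by lia),
        show (i + t - (n - u)).toNat = (i + t + u - n).toNat by congr 1; ring,
        show (t + u - (n - i)).toNat = (i + t + u - n).toNat by congr 1; ring]
      have := congrArg (a.coeff i * ·)
        (assoc_aux i t (i + t + u - n).toNat (b.coeff t) (c.coeff u))
      simp only [Finset.mul_sum] at this
      convert this using 1
      · refine Finset.sum_congr rfl fun jk hjk => ?_
        have hD := Finset.HasAntidiagonal.mem_antidiagonal.mp hjk
        rw [show (i + t - jk.1 + u - n).toNat = jk.2 by lia,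
          show (i + t - (i + t - (jk.1 : ℤ))).toNat = jk.1 by lia]
        simp only [zsmul_eq_mul]
        push_cast
        ring
      · refine Finset.sum_congr rfl fun jk hjk => ?_
        have hD := Finset.HasAntidiagonal.mem_antidiagonal.mp hjk
        rw [show (i + (t + u - jk.1) - n).toNat = jk.2 by lia,
          show (t + u - (t + u - (jk.1 : ℤ))).toNat = jk.1 by lia]
        rw [map_zsmul]
        simp only [zsmul_eq_mul]
        push_cast
        ring
    · rw [if_neg (by lia), if_neg (by lia)]
  trans ∑ i ∈ Finset.Icc (n - B - C) A, ∑ t ∈ Finset.Icc (n - A - C) B,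
      ∑ u ∈ Finset.Icc (n - A - B) C,
      (∑ s ∈ Finset.Icc (n - C) (A + B), if n - u ≤ s ∧ s ≤ i + t then
        Ring.choose s (s + u - n).toNat • ((Ring.choose i (i + t - s).toNat •
          (a.coeff i * iterDeriv (i + t - s).toNat (b.coeff t))) *
            iterDeriv (s + u - n).toNat (c.coeff u)) else 0)
  · have h1 : ∀ s ∈ Finset.Icc (n - C) (A + B), ∀ u ∈ Finset.Icc (n - A - B) C,
        mulTerm (a * b).coeff c.coeff n s u =
        ∑ i ∈ Finset.Icc (n - B - C) A, ∑ t ∈ Finset.Icc (n - A - C) B,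
          if n - u ≤ s ∧ s ≤ i + t then
        Ring.choose s (s + u - n).toNat • ((Ring.choose i (i + t - s).toNat •
          (a.coeff i * iterDeriv (i + t - s).toNat (b.coeff t))) *
            iterDeriv (s + u - n).toNat (c.coeff u)) else 0 := by
      intro s hs u hu
      rw [Finset.mem_Icc] at hs hu
      rw [mulTerm, coeff_mul_eq (lo := n - B - C) (lo' := n - A - C) ha hb
        le_rfl le_rfl (by lia) (by lia)]
      split_ifs with h
      · rw [Finset.sum_mul, Finset.smul_sum]
        refine Finset.sum_congr rfl fun i _ => ?_
        rw [Finset.sum_mul, Finset.smul_sum]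
        refine Finset.sum_congr rfl fun t _ => ?_
        rw [mulTerm]
        by_cases h' : s ≤ i + t
        · rw [if_pos h', if_pos (by lia)]
        · rw [if_neg h', if_neg (by lia)]; simp
      · symm
        refine Finset.sum_eq_zero fun i _ => Finset.sum_eq_zero fun t _ => if_neg (by lia)
    rw [Finset.sum_congr rfl fun s hs => Finset.sum_congr rfl fun u hu => h1 s hs u hu]
    simp only [Finset.sum_comm (s := Finset.Icc (n - C) (A + B))]
    refine Eq.trans (Finset.sum_comm) ?_
    refine Finset.sum_congr rfl fun i _ => ?_
    refine Eq.trans (Finset.sum_comm) ?_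
    rfl
  · rw [Finset.sum_congr rfl fun i hi => Finset.sum_congr rfl fun t ht =>
      Finset.sum_congr rfl fun u hu => key i t u (Finset.mem_Icc.mp hi).2
        (Finset.mem_Icc.mp ht).2 (Finset.mem_Icc.mp hu).2]
    refine Finset.sum_congr rfl fun i hi => ?_
    have h1 : ∀ v ∈ Finset.Icc (n - A) (B + C),
        mulTerm a.coeff (b * c).coeff n i v =
        ∑ t ∈ Finset.Icc (n - A - C) B, ∑ u ∈ Finset.Icc (n - A - B) C,
          if n - i ≤ v ∧ v ≤ t + u then
        Ring.choose i (i + v - n).toNat • (a.coeff i * iterDeriv (i + v - n).toNat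
          (Ring.choose t (t + u - v).toNat •
            (b.coeff t * iterDeriv (t + u - v).toNat (c.coeff u)))) else 0 := by
      intro v hv
      rw [Finset.mem_Icc] at hv
      rw [mulTerm, coeff_mul_eq (lo := n - A - C) (lo' := n - A - B) hb hc
        le_rfl le_rfl (by lia) (by lia)]
      split_ifs with h
      · rw [map_sum, Finset.mul_sum, Finset.smul_sum]
        refine Finset.sum_congr rfl fun t _ => ?_
        rw [map_sum, Finset.mul_sum, Finset.smul_sum]
        refine Finset.sum_congr rfl fun u _ => ?_
        rw [mulTerm]
        by_cases h' : v ≤ t + u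
        · rw [if_pos h', if_pos (by lia)]
        · rw [if_neg h', if_neg (by lia)]; simp
      · symm
        refine Finset.sum_eq_zero fun i _ => Finset.sum_eq_zero fun t _ => if_neg (by lia)
    rw [Finset.sum_congr rfl h1]
    simp only [Finset.sum_comm (s := Finset.Icc (n - A) (B + C))]

noncomputable instance : Ring (PsiDO V) where
  __ := (inferInstance : AddCommGroup (PsiDO V))
  left_distrib := PsiDO.mul_add
  right_distrib := PsiDO.add_mul
  zero_mul := PsiDO.zero_mul
  mul_zero := PsiDO.mul_zero
  mul_assoc := PsiDO.mul_assoc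
  one_mul := PsiDO.one_mul
  mul_one := PsiDO.mul_one

end PsiDO

end PseudoDifferential

section Quasidet

variable {R : Type*} [Ring R] {n m : Type*} [Fintype n] [DecidableEq n] [Fintype m] [DecidableEq m]

/-- The `(I, J)`-quasideterminant `|A|_{IJ}` exists: `A` and `J A⁻¹ I` are invertible matrices. -/
def QuasidetExists (A : Matrix n n R) (I : Matrix n m R) (J : Matrix m n R) : Prop :=
  IsUnit A ∧ IsUnit (J * Ring.inverse A * I)

/-- The `(I, J)`-quasideterminant `|A|_{IJ} = (J A⁻¹ I)⁻¹`
(meaningful when `QuasidetExists A I J`; `Ring.inverse` is the two-sided inverse of a unit). -/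
noncomputable def quasidet (A : Matrix n n R) (I : Matrix n m R) (J : Matrix m n R) :
    Matrix m m R :=
  Ring.inverse (J * Ring.inverse A * I)

end Quasidet

section Factorization

variable {F : Type*} [Field F] {m k : Type*} [Fintype m] [DecidableEq m] [Fintype k]

/-- `S = I J` is the canonical factorization of the square matrix `S`: for some basis of `im S`,
`I` is the matrix of the inclusion of `im S` and `J` is the matrix of the surjection
`X ↦ S X` onto `im S`. -/
def IsCanonicalFactorization (S : Matrix m m F) (I : Matrix m k F) (J : Matrix k m F) : Prop :=
  ∃ b : Module.Basis k F (LinearMap.range S.mulVecLin),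
    (∀ i a, I i a = (b a : m → F) i) ∧
    ∀ a j, J a j = b.repr (S.mulVecLin.rangeRestrict (Pi.single j 1)) a

end Factorization

section FractionField

variable {V : Type*} [CommRing V] [IsDomain V] [Differential V]

/-- `a ↦ a + ε a'`, with values in the dual numbers over the field of fractions. -/
noncomputable def fracDerivAux :
    V →+* TrivSqZeroExt (FractionRing V) (FractionRing V) where
  toFun a := TrivSqZeroExt.inl (algebraMap V (FractionRing V) a) +
    TrivSqZeroExt.inr (algebraMap V (FractionRing V) (Differential.deriv a))
  map_one' := by simp
  map_zero' := by simp
  map_add' a b := by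
    ext <;> simp [Algebra.smul_def]
  map_mul' a b := by
    ext
    · simp
    · simp only [TrivSqZeroExt.snd_add, TrivSqZeroExt.snd_inl, TrivSqZeroExt.snd_inr,
        TrivSqZeroExt.snd_mul, TrivSqZeroExt.fst_add, TrivSqZeroExt.fst_inl,
        TrivSqZeroExt.fst_inr, Derivation.leibniz, map_add, map_mul, smul_eq_mul,
        MulOpposite.smul_eq_mul_unop, MulOpposite.unop_op]
      ring

/-- The same on the field of fractions. -/
noncomputable def fracDerivLift :
    FractionRing V →+* TrivSqZeroExt (FractionRing V) (FractionRing V) :=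
  IsLocalization.lift (M := nonZeroDivisors V) (g := fracDerivAux) (by
    intro y
    rw [TrivSqZeroExt.isUnit_iff_isUnit_fst]
    simp [fracDerivAux])

theorem fracDerivLift_algebraMap (a : V) :
    fracDerivLift (algebraMap V (FractionRing V) a) = fracDerivAux a :=
  IsLocalization.lift_eq _ a

theorem fst_fracDerivLift (x : FractionRing V) : (fracDerivLift x).fst = x := by
  have : ((TrivSqZeroExt.fstHom (FractionRing V) (FractionRing V) (FractionRing V)).toRingHom.comp
      fracDerivLift) = RingHom.id (FractionRing V) := by
    apply IsLocalization.ringHom_ext (nonZeroDivisors V)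
    ext a
    simp [fracDerivLift_algebraMap, fracDerivAux]
  exact RingHom.congr_fun this x

/-- An additive map satisfying the Leibniz rule makes a commutative ring differential. -/
abbrev differentialOfLeibniz {K : Type*} [CommRing K] (D : K →+ K)
    (h : ∀ a b, D (a * b) = a * D b + b * D a) : Differential K where
  deriv := Derivation.mk' D.toIntLinearMap h

/-- The derivation of a differential domain extended to its field of fractions. -/
noncomputable instance FractionRing.instDifferential : Differential (FractionRing V) :=
  differentialOfLeibniz
    { toFun := fun x => (fracDerivLift x).snd
      map_zero' := by simp
      map_add' := by simp }
    (by
      intro a b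
      simp [fst_fracDerivLift, mul_comm])

instance FractionRing.instDifferentialAlgebra : DifferentialAlgebra V (FractionRing V) where
  deriv_algebraMap a := by
    change (fracDerivLift _).snd = _
    simp only [fracDerivLift_algebraMap, fracDerivAux, RingHom.coe_mk, MonoidHom.coe_mk,
      OneHom.coe_mk, TrivSqZeroExt.snd_add, TrivSqZeroExt.snd_inl, TrivSqZeroExt.snd_inr, zero_add]

end FractionField

section DiffPoly

variable {F : Type*} [Field F] {ι : Type*}

/-- Differential polynomials over `F` in the differential indeterminates `uᵢ`, `i ∈ ι`:
polynomials in the `uᵢ⁽ⁿ⁾ = X (i, n)`. -/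
abbrev DiffPoly (ι F : Type*) [Field F] : Type _ := MvPolynomial (ι × ℕ) F

/-- The derivation `∂ uᵢ⁽ⁿ⁾ = uᵢ⁽ⁿ⁺¹⁾`, zero on `F`. -/
noncomputable instance DiffPoly.instDifferential : Differential (DiffPoly ι F) where
  deriv := (MvPolynomial.mkDerivation F
    (fun v : ι × ℕ => (MvPolynomial.X (v.1, v.2 + 1) : DiffPoly ι F))).restrictScalars ℤ

/-- The operator `λ + ∂` on `V[λ]`, with `∂` acting on coefficients. -/
noncomputable def lamDel {V : Type*} [CommRing V] [Differential V] : Module.End ℤ (Polynomial V) :=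
  LinearMap.mulLeft ℤ Polynomial.X + (Differential.mapCoeffs (A := V)).toLinearMap

/-- `{f_λ uⱼ} = ∑_{i,m} {uᵢ_{λ+∂} uⱼ}_→ (-λ-∂)ᵐ (∂f/∂uᵢ⁽ᵐ⁾)`, for prescribed `G i j = {uᵢ_λ uⱼ}`. -/
noncomputable def lambdaBracketGen (G : ι → ι → Polynomial (DiffPoly ι F)) (f : DiffPoly ι F)
    (j : ι) : Polynomial (DiffPoly ι F) :=
  ∑ v ∈ f.vars, (G v.1 j).sum fun k c => Polynomial.C c *
    (lamDel ^ k) (((-lamDel) ^ v.2) (Polynomial.C (MvPolynomial.pderiv v f)))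

/-- The `λ`-bracket on differential polynomials with prescribed values `{uᵢ_λ uⱼ} = G i j` on
generators, extended by sesquilinearity and the Leibniz rules:
`{f_λ g} = ∑ (∂g/∂uⱼ⁽ⁿ⁾) (λ+∂)ⁿ {uᵢ_{λ+∂} uⱼ}_→ (-λ-∂)ᵐ (∂f/∂uᵢ⁽ᵐ⁾)`. -/
noncomputable def lambdaBracket (G : ι → ι → Polynomial (DiffPoly ι F)) (f : DiffPoly ι F) :
    Derivation F (DiffPoly ι F) (Polynomial (DiffPoly ι F)) :=
  MvPolynomial.mkDerivation F (fun w : ι × ℕ => (lamDel ^ w.2) (lambdaBracketGen G f w.1))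

end DiffPoly

/-- A partition `p₁ ≥ p₂ ≥ ... ≥ p_{r+1} > 0` (rows are indexed from `0` in the code). -/
structure Pyramid where
  r : ℕ
  p : Fin (r + 1) → ℕ
  p_pos : ∀ i, 0 < p i
  p_anti : Antitone p

namespace Pyramid

variable (F : Type*) [Field F] (P : Pyramid)

/-- The boxes of the pyramid; the pair `⟨i, h⟩` is the box `(i + 1, h + 1)`. -/
abbrev Box : Type := Σ i : Fin (P.r + 1), Fin (P.p i)

/-- The rows of maximal length `p₁`. There are `r₁` of them. -/
abbrev TopRow : Type := {i : Fin (P.r + 1) // P.p i = P.p 0}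

/-- The box `(i, 1)`. -/
def firstBox (i : P.TopRow) : P.Box := ⟨i.1, ⟨0, P.p_pos i.1⟩⟩

/-- The box `(i, pᵢ)`. -/
def lastBox (i : P.TopRow) : P.Box := ⟨i.1, ⟨P.p i.1 - 1, Nat.sub_lt (P.p_pos i.1) one_pos⟩⟩

/-- `𝔤 = 𝔤𝔩_N`, as matrices indexed by the boxes. -/
abbrev Gl : Type _ := Matrix P.Box P.Box F

/-- The elementary matrix `E_{ab}` for `u = (a, b)`. -/
def elem (u : P.Box × P.Box) : P.Gl F := Matrix.single u.1 u.2 1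

/-- The nilpotent `f = ∑ E_{(i,h+1),(i,h)}`. -/
def nil : P.Gl F :=
  Matrix.of fun a b => if a.1 = b.1 ∧ (a.2 : ℕ) = (b.2 : ℕ) + 1 then 1 else 0

variable {P} in
/-- The eigenvalue `(pᵢ + 1 - 2h)/2` of `x` on the basis vector `e_{ih}`. -/
def xCoord (a : P.Box) : ℚ := ((P.p a.1 : ℚ) + 1 - 2 * ((a.2 : ℕ) + 1)) / 2

/-- The diagonal matrix `x`. -/
def xMat : P.Gl F := Matrix.diagonal fun a => ((xCoord a : ℚ) : F)

/-- The eigenspace `𝔤_k` of `ad x`. -/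
def gPart (k : ℚ) : Submodule F (P.Gl F) where
  carrier := {a | ⁅P.xMat F, a⁆ = (k : F) • a}
  zero_mem' := by simp [Ring.lie_def]
  add_mem' := by
    intro a b ha hb
    simp only [Set.mem_ofPred_eq] at ha hb ⊢
    rw [smul_add, ← ha, ← hb]
    simp only [Ring.lie_def, mul_add, add_mul]
    abel
  smul_mem' := by
    intro c a ha
    simp only [Set.mem_ofPred_eq] at ha ⊢
    rw [smul_comm, ← ha]
    simp only [Ring.lie_def, Matrix.mul_smul, Matrix.smul_mul, smul_sub]

/-- `𝔤_{≥1/2}`. -/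
def gGeHalf : Submodule F (P.Gl F) := ⨆ k : ℚ, ⨆ _ : 1 / 2 ≤ k, P.gPart F k

/-- The depth `d = p₁ - 1` of the grading. -/
def depth : ℚ := (P.p 0 : ℚ) - 1

/-- `𝒱(𝔤)`, the differential polynomials over `𝔤`, in the basis `q_{ab} = E_{ab}` of `𝔤`. -/
abbrev VG : Type _ := DiffPoly (P.Box × P.Box) F

/-- Index set of the basis `E_{ab}`, `x_a - x_b ≤ 1/2`, of `𝔤_{≤1/2}`. -/
abbrev LowIdx : Type := {u : P.Box × P.Box // xCoord u.1 - xCoord u.2 ≤ 1 / 2}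

/-- `𝒱(𝔤_{≤1/2})`. -/
abbrev VLow : Type _ := DiffPoly P.LowIdx F

/-- The field of fractions `𝒦(𝔤_{≤1/2})` of `𝒱(𝔤_{≤1/2})`. -/
abbrev KLow : Type _ := FractionRing (P.VLow F)

variable {F P}

/-- The inclusion `𝔤 ⊆ 𝒱(𝔤)`. -/
noncomputable def q (a : P.Gl F) : P.VG F :=
  ∑ u : P.Box × P.Box, a u.1 u.2 • MvPolynomial.X (u, 0)

/-- The inclusion `𝒱(𝔤_{≤1/2}) ⊆ 𝒱(𝔤)`. -/
noncomputable def incl : P.VLow F →ₐ[F] P.VG F :=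
  MvPolynomial.rename (Prod.map Subtype.val id)

/-- `ρ(q_u) = π_{≤1/2}(q_u) + (f | E_u)` for the trace form. -/
noncomputable def rhoGen (u : P.Box × P.Box) : P.VLow F :=
  (if h : xCoord u.1 - xCoord u.2 ≤ 1 / 2 then MvPolynomial.X (⟨u, h⟩, 0) else 0) +
    MvPolynomial.C (Matrix.trace (P.nil F * P.elem F u))

/-- The differential algebra homomorphism `ρ : 𝒱(𝔤) → 𝒱(𝔤_{≤1/2})`,
`ρ(a) = π_{≤1/2}(a) + (f | a)`. -/
noncomputable def rho : P.VG F →ₐ[F] P.VLow F :=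
  MvPolynomial.aeval fun v => PsiDO.iterDeriv v.2 (rhoGen v.1)

/-- `{a_λ b}_ε = [a, b] + (a | b) λ + ε (S | [a, b])` on the basis elements of `𝔤`. -/
noncomputable def affineGen (ε : F) (S : P.Gl F) (u v : P.Box × P.Box) :
    Polynomial (P.VG F) :=
  Polynomial.C (q ⁅P.elem F u, P.elem F v⁆) +
    Polynomial.C (MvPolynomial.C (Matrix.trace (P.elem F u * P.elem F v))) * Polynomial.X +
    Polynomial.C (MvPolynomial.C (ε * Matrix.trace (S * ⁅P.elem F u, P.elem F v⁆)))

/-- The `λ`-bracket `{·_λ ·}_ε` of the affine Poisson vertex algebra `𝒱_ε(𝔤, S)`. -/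
noncomputable def affineBracket (ε : F) (S : P.Gl F) (f : P.VG F) :
    Derivation F (P.VG F) (Polynomial (P.VG F)) :=
  lambdaBracket (affineGen ε S) f

/-- The classical affine `𝒲`-algebra
`{w ∈ 𝒱(𝔤_{≤1/2}) | ρ{a_λ w}_ε = 0 for all a ∈ 𝔤_{≥1/2}}`, as a subalgebra. -/
noncomputable def W (ε : F) (S : P.Gl F) : Subalgebra F (P.VLow F) where
  carrier := {w | ∀ a ∈ P.gGeHalf F,
    (affineBracket ε S (q a) (incl w)).map (rho : P.VG F →ₐ[F] P.VLow F).toRingHom = 0}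
  mul_mem' := by
    intro u v hu hv a ha
    rw [map_mul, Derivation.leibniz, Polynomial.map_add, Polynomial.smul_eq_C_mul,
      Polynomial.smul_eq_C_mul, Polynomial.map_mul, Polynomial.map_mul, hu a ha, hv a ha]
    simp
  add_mem' := by
    intro u v hu hv a ha
    rw [map_add, map_add, Polynomial.map_add, hu a ha, hv a ha, add_zero]
  algebraMap_mem' := by
    intro c a _
    rw [AlgHom.commutes, Derivation.map_algebraMap, Polynomial.map_zero]

/-- The field of fractions of `𝒲`, inside `𝒦(𝔤_{≤1/2})`. -/
noncomputable def fracW (ε : F) (S : P.Gl F) : Subfield (P.KLow F) :=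
  Subfield.closure (algebraMap (P.VLow F) (P.KLow F) '' (W ε S : Set (P.VLow F)))

/-- A matrix of constants as a matrix of pseudodifferential operators. -/
def constMat {m n : Type*} (V : Type*) [CommRing V] [Algebra F V] (M : Matrix m n F) :
    Matrix m n (PsiDO V) :=
  M.map fun c => PsiDO.const (algebraMap F V c)

variable (F P)

/-- `I₁ = ∑ᵢ E_{(i,1), i}`. -/
def I1 : Matrix P.Box P.TopRow F := Matrix.of fun a i => if a = P.firstBox i then 1 else 0

/-- `J₁ = ∑ᵢ E_{i, (i,p₁)}`. -/
def J1 : Matrix P.TopRow P.Box F := Matrix.of fun i a => if a = P.lastBox i then 1 else 0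

/-- `ρ(A(∂)) = 𝟙_N ∂ + ρ(Q)`, where `Q` has the entry `q_{ba}` in position `(a, b)`. -/
noncomputable def rhoA : Matrix P.Box P.Box (PsiDO (P.VLow F)) :=
  Matrix.diagonal (fun _ => PsiDO.del) +
    Matrix.of fun a b => PsiDO.const (rho (q (P.elem F (b, a))))

/-- `L₁(∂) = |𝟙_N ∂ + ρ(Q)|_{I₁ J₁}`. -/
noncomputable def L1 : Matrix P.TopRow P.TopRow (PsiDO (P.VLow F)) :=
  quasidet (P.rhoA F) (constMat _ (P.I1 F)) (constMat _ (P.J1 F))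

/-- `L₁(∂)` with its coefficients viewed in the field of fractions `𝒦(𝔤_{≤1/2})`. -/
noncomputable def L1K : Matrix P.TopRow P.TopRow (PsiDO (P.KLow F)) :=
  (P.L1 F).map (PsiDO.map (algebraMap (P.VLow F) (P.KLow F)))

variable {F P}

/-- The matrix `S̄ = (s_{ij})` of `S = ∑ s_{ij} E_{(i,1),(j,p₁)} ∈ 𝔤_d`. -/
def barS (S : P.Gl F) : Matrix P.TopRow P.TopRow F :=
  S.submatrix P.firstBox P.lastBox

end Pyramid

/-!
Write `𝒱 = 𝒱(𝔤_{≤1/2})` and `A = ∂ + ρ(Q)`, so that `L₁(∂) = (J₁ A⁻¹ I₁)⁻¹`.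

*Existence of `L₁(∂)`.* Any matrix `∂ + B` over `𝒱` is invertible by a geometric series. For the
invertibility of `J₁ A⁻¹ I₁`, weight the boxes by twice the eigenvalue of `x` and filter the
matrices of pseudodifferential operators accordingly (`HasLevel`). By degree reasons `ρ(Q) - f` has
lower level than `∂ + f`, so `A⁻¹` and `(∂ + f)⁻¹`, which is explicit, have the same leading part.
The corner `J₁ A⁻¹ I₁` is thus `±∂^{-p₁}` up to lower order (`exists_inverse_rhoA_eq`), and it is
invertible by another geometric series.

*Coefficients in `𝒲`.* For `m ∈ 𝔤_{≥1/2}` the map `D w = ρ{m_λ w}` is a derivation `𝒱 → 𝒱[λ]` with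
`D ∂ = (λ + ∂) D`. Equivalently, `v ↦ v + D(v) δ` is a homomorphism of differential rings from `𝒱`
to `𝒱[λ] ⊕ 𝒱[λ] δ`, where `δ² = 0` and `δ' = λ δ` (`gaugeHom`). As `ρ{m_λ ρ(Q)} = [ρ(Q), m] + λ m`
(`rhoBracket_rhoQ`), this homomorphism conjugates `A` by `1 + m δ` (`gaugePsi_rhoA`). Since
`J₁ m = 0 = m I₁`, it fixes `J₁ A⁻¹ I₁`, hence also the inverse `L₁(∂)`; that all these
homomorphisms fix an operator means that its coefficients lie in `𝒲` (`coeff_mem_W_iff`).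

*Existence of `L(∂)`.* The operators over the differential field of fractions of `𝒱` form a division
ring, and there is a specialization principle: a matrix of operators over `𝒱` which becomes the
identity under some homomorphism of differential rings `𝒱 → 𝒱'` is invertible over the field of
fractions (`PsiDO.isUnit_map_of_map_eq_one`). The differential variables are specialized to
constants for which `ρ(Q)` becomes `f + I₁ W J₁`, where `W` is an invertible matrix of constants;
then `L₁(∂)` becomes `±∂^{p₁} + W` (`specPsi_inverse_L1_mul`). Now the operators have constant
coefficients, so the specialization of `J L₁(∂)⁻¹ I` is invertible as soon as a determinant over
`F[t]` with `t = ±∂^{p₁}` does not vanish. At `t = 0` this determinant is nonzero if `J W⁻¹ I` is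
invertible, and such a `W` exists because `I` has a left inverse and `J` a right inverse
(`exists_isUnit_mul_mul`).

*Coefficients in the field of fractions of `𝒲`.* The matrix `J L₁(∂)⁻¹ I` has coefficients in `𝒲`,
whose field of fractions is closed under the derivation. A matrix of operators over a differential
subfield which is invertible over the larger field is invertible over the subfield
(`PsiDO.coeff_inverse_mem`).
-/

open scoped Differential Matrix Polynomial

/-! ### Pseudodifferential operators -/

namespace PsiDO

section Basic

variable {V : Type*} [CommRing V]

/-- `a` has order at most `k`: the coefficients of `∂ᵐ` vanish for `m > k`. -/
def OrderLE (k : ℤ) (a : PsiDO V) : Prop := ∀ m, k < m → a.coeff m = 0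

theorem OrderLE.mono {k l : ℤ} {a : PsiDO V} (h : OrderLE k a) (hkl : k ≤ l) : OrderLE l a :=
  fun m hm => h m (by lia)

theorem orderLE_monomial (m : ℤ) (v : V) : OrderLE m (monomial m v) :=
  fun _ hn => if_neg hn.ne'

@[simp] theorem coeff_neg (a : PsiDO V) (n : ℤ) : (-a).coeff n = -a.coeff n := rfl

@[simp] theorem coeff_sub (a b : PsiDO V) (n : ℤ) :
    (a - b).coeff n = a.coeff n - b.coeff n := by
  rw [sub_eq_add_neg, coeff_add, coeff_neg, sub_eq_add_neg]

/-- Taking the coefficient of `∂ⁿ`, as an additive map. -/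
def coeffHom (n : ℤ) : PsiDO V →+ V where
  toFun a := a.coeff n
  map_zero' := rfl
  map_add' _ _ := rfl

theorem coeff_sum {ι : Type*} (s : Finset ι) (f : ι → PsiDO V) (n : ℤ) :
    (∑ i ∈ s, f i).coeff n = ∑ i ∈ s, (f i).coeff n :=
  map_sum (coeffHom n) f s

theorem coeff_const (v : V) (n : ℤ) : (const v).coeff n = if n = 0 then v else 0 := rfl

theorem coeff_one (n : ℤ) : (1 : PsiDO V).coeff n = if n = 0 then 1 else 0 := rfl

theorem monomial_zero_one : (monomial 0 1 : PsiDO V) = 1 := rfl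

theorem map_monomial {V' : Type*} [CommRing V'] (φ : V →+* V') (m : ℤ) (v : V) :
    map φ (monomial m v) = monomial m (φ v) := by
  ext n; simp [coeff_monomial, apply_ite φ]

theorem map_const {V' : Type*} [CommRing V'] (φ : V →+* V') (v : V) :
    map φ (const v) = const (φ v) := map_monomial φ 0 v

theorem map_del {V' : Type*} [CommRing V'] (φ : V →+* V') :
    map φ (del : PsiDO V) = del := by rw [del, map_monomial, map_one, del]

end Basic

variable {V : Type*} [CommRing V] [Differential V]

theorem OrderLE.mul {k l : ℤ} {a b : PsiDO V} (ha : OrderLE k a) (hb : OrderLE l b) :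
    OrderLE (k + l) (a * b) := mul_bound ha hb

/-- The leading coefficient of a product. -/
theorem coeff_mul_top {k l : ℤ} {a b : PsiDO V} (ha : OrderLE k a) (hb : OrderLE l b) :
    (a * b).coeff (k + l) = a.coeff k * b.coeff l := by
  rw [coeff_mul_eq (lo := k) (lo' := l) ha hb le_rfl le_rfl (by lia) (by lia)]
  simp [mulTerm, iterDeriv_zero]

theorem coeff_mul_monomial_one (a : PsiDO V) (n m : ℤ) :
    (a * monomial n 1).coeff m = a.coeff (m - n) := by
  rw [coeff_mul, finsum_eq_single _ ((m - n : ℤ), (0 : ℕ))]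
  · simp [coeff_monomial, iterDeriv_zero]
  · rintro ⟨i, k⟩ h
    simp only [coeff_monomial]
    split_ifs with hi
    · have hk : k ≠ 0 := by
        rintro rfl
        exact h (by simp only [Prod.mk.injEq, and_true]; simp at hi; lia)
      simp [iterDeriv_one_pos hk]
    · simp

theorem monomial_mul_monomial_one (m n : ℤ) (v : V) :
    monomial m v * monomial n 1 = monomial (m + n) v := by
  ext k
  rw [coeff_mul_monomial_one, coeff_monomial, coeff_monomial]
  congr 1
  simp only [eq_iff_iff]
  lia

theorem isUnit_monomial_one (m : ℤ) : IsUnit (monomial m 1 : PsiDO V) :=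
  ⟨⟨monomial m 1, monomial (-m) 1, by simp [monomial_mul_monomial_one, monomial_zero_one],
    by simp [monomial_mul_monomial_one, monomial_zero_one]⟩, rfl⟩

theorem const_mul_monomial (v : V) (m : ℤ) (w : V) :
    const v * monomial m w = monomial m (v * w) := by
  ext n
  rw [const_mul_coeff, coeff_monomial, coeff_monomial]
  simp

/-- The inclusion of `V` as operators of order zero. -/
def constHom (V : Type*) [CommRing V] [Differential V] : V →+* PsiDO V where
  toFun := const
  map_one' := rfl
  map_zero' := by ext; simp [coeff_const]
  map_add' a b := by ext n; simp only [coeff_const, coeff_add]; split_ifs <;> simp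
  map_mul' a b := (const_mul_monomial a 0 b).symm

theorem constHom_apply (v : V) : constHom V v = const v := rfl

/-- The relation `∂ ∘ v = v ∂ + v'`. -/
theorem del_mul_const (v : V) : del * const v = const v * del + const v′ := by
  ext n
  have h := coeff_mul_eq (n := n) (lo := min n 1) (lo' := min (n - 1) 0)
    (orderLE_monomial 1 (1 : V)) (orderLE_monomial 0 v) le_rfl le_rfl (by lia) (by lia)
  refine h.trans ?_
  rw [coeff_add, const_mul_coeff]
  rw [Finset.sum_eq_single 1, Finset.sum_eq_single 0]
  · simp only [mulTerm, del, const, coeff_monomial]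
    by_cases h1 : n = 1
    · subst h1; simp [iterDeriv_zero]
    by_cases h0 : n = 0
    · subst h0; simp [iterDeriv_succ, iterDeriv_zero]
    by_cases h : n ≤ 1 + 0
    · rw [if_pos h]
      obtain ⟨k, hk⟩ : ∃ k : ℕ, (1 + 0 - n).toNat = k + 2 := ⟨(1 + 0 - n).toNat - 2, by lia⟩
      rw [hk]
      have : Ring.choose (1 : ℤ) (k + 2) = 0 := by
        have := Ring.choose_natCast (R := ℤ) 1 (k + 2)
        rw [Nat.cast_one] at this
        rw [this, Nat.choose_eq_zero_of_lt (by lia)]; rfl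
      simp [this, h1, h0]
    · rw [if_neg h]; simp [h1, h0]
  · intro t _ ht
    simp [mulTerm, coeff_monomial, ht]
  · intro h; simp at h
  · intro i _ hi
    refine Finset.sum_eq_zero fun t _ => ?_
    simp [mulTerm, coeff_monomial, hi]
  · intro h; simp at h

theorem iterDeriv_map {V' : Type*} [CommRing V'] [Differential V'] (φ : V →+* V')
    (hφ : ∀ v, φ v′ = (φ v)′) (k : ℕ) (v : V) : φ (iterDeriv k v) = iterDeriv k (φ v) := by
  induction k with
  | zero => rfl
  | succ k ih => rw [iterDeriv_succ, iterDeriv_succ, hφ, ih]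

/-- A homomorphism of differential rings induces a homomorphism of the rings of
pseudodifferential operators. -/
def mapHom {V' : Type*} [CommRing V'] [Differential V'] (φ : V →+* V')
    (hφ : ∀ v, φ v′ = (φ v)′) : PsiDO V →+* PsiDO V' where
  toFun := map φ
  map_one' := by ext n; simp [coeff_one, apply_ite φ]
  map_zero' := by ext n; simp
  map_add' a b := by ext n; simp
  map_mul' a b := by
    obtain ⟨A, ha⟩ := a.exists_bound
    obtain ⟨B, hb⟩ := b.exists_bound
    ext n
    rw [coeff_map, coeff_mul_eq (lo := n - B) (lo' := n - A) ha hb le_rfl le_rfl le_rfl le_rfl,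
      coeff_mul_eq (A := A) (B := B) (lo := n - B) (lo' := n - A)
        (fun m hm => by simp [ha m hm]) (fun m hm => by simp [hb m hm]) le_rfl le_rfl le_rfl le_rfl]
    simp only [map_sum, mulTerm, coeff_map]
    refine Finset.sum_congr rfl fun i _ => Finset.sum_congr rfl fun t _ => ?_
    split_ifs
    · rw [map_zsmul, map_mul, iterDeriv_map φ hφ]
    · simp

theorem mapHom_apply {V' : Type*} [CommRing V'] [Differential V'] (φ : V →+* V')
    (hφ : ∀ v, φ v′ = (φ v)′) (a : PsiDO V) : mapHom φ hφ a = map φ a := rfl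

/-! ### A filtration on matrices of pseudodifferential operators -/

section Level

variable {V : Type*} [CommRing V] {n : Type*}

/-- A matrix of pseudodifferential operators has level at most `k`, for given weights `w` of the
indices, if its `(a, b)` entry has order at most `(k + w a - w b) / 2`. -/
def HasLevel (w : n → ℤ) (k : ℤ) (M : Matrix n n (PsiDO V)) : Prop :=
  ∀ a b m, k + w a - w b < 2 * m → (M a b).coeff m = 0

theorem HasLevel.mono {w : n → ℤ} {k l : ℤ} {M : Matrix n n (PsiDO V)} (h : HasLevel w k M)
    (hkl : k ≤ l) : HasLevel w l M := fun a b m hm => h a b m (by lia)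

theorem HasLevel.add {w : n → ℤ} {k : ℤ} {M N : Matrix n n (PsiDO V)} (hM : HasLevel w k M)
    (hN : HasLevel w k N) : HasLevel w k (M + N) := fun a b m hm => by
  rw [Matrix.add_apply, coeff_add, hM a b m hm, hN a b m hm, add_zero]

theorem HasLevel.neg {w : n → ℤ} {k : ℤ} {M : Matrix n n (PsiDO V)} (hM : HasLevel w k M) :
    HasLevel w k (-M) := fun a b m hm => by
  rw [Matrix.neg_apply, coeff_neg, hM a b m hm, neg_zero]

theorem HasLevel.sum {w : n → ℤ} {k : ℤ} {ι : Type*} (s : Finset ι)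
    {M : ι → Matrix n n (PsiDO V)} (h : ∀ i ∈ s, HasLevel w k (M i)) :
    HasLevel w k (∑ i ∈ s, M i) := fun a b m hm => by
  rw [Matrix.sum_apply, coeff_sum]
  exact Finset.sum_eq_zero fun i hi => h i hi a b m hm

theorem eq_zero_of_hasLevel {w : n → ℤ} {k : ℤ} (hk : k < 0) {M : Matrix n n (PsiDO V)}
    (h : ∀ j : ℕ, HasLevel w (j * k) M) : M = 0 := by
  ext a b m
  refine h (w a - w b - 2 * m + 1).toNat a b m ?_
  nlinarith [Int.self_le_toNat (w a - w b - 2 * m + 1),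
    Int.natCast_nonneg (w a - w b - 2 * m + 1).toNat]

theorem hasLevel_one [DecidableEq n] {w : n → ℤ} :
    HasLevel w 0 (1 : Matrix n n (PsiDO V)) := fun a b m hm => by
  rw [Matrix.one_apply]
  split_ifs with h
  · subst h; rw [coeff_one, if_neg (by lia)]
  · rfl

end Level

section Level

variable {n : Type*} [Fintype n]

theorem HasLevel.mul {w : n → ℤ} {k l : ℤ} {M N : Matrix n n (PsiDO V)} (hM : HasLevel w k M)
    (hN : HasLevel w l N) : HasLevel w (k + l) (M * N) := fun a b m hm => by
  rw [Matrix.mul_apply, coeff_sum]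
  refine Finset.sum_eq_zero fun c _ => ?_
  have h1 : OrderLE ((k + w a - w c) / 2) (M a c) := fun m hm => hM a c m (by lia)
  have h2 : OrderLE ((l + w c - w b) / 2) (N c b) := fun m hm => hN c b m (by lia)
  exact h1.mul h2 m (by lia)

variable [DecidableEq n]

theorem HasLevel.pow {w : n → ℤ} {k : ℤ} {M : Matrix n n (PsiDO V)} (hM : HasLevel w k M)
    (j : ℕ) : HasLevel w (j * k) (M ^ j) := by
  induction j with
  | zero => simpa using hasLevel_one
  | succ j ih =>
    rw [pow_succ, Nat.cast_succ, add_mul, one_mul]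
    exact ih.mul hM

/-- `1 - T` is invertible if `T` has negative level: the geometric series converges. -/
theorem exists_inverse_one_sub {w : n → ℤ} {k : ℤ} (hk : k < 0) {T : Matrix n n (PsiDO V)}
    (hT : HasLevel w k T) :
    ∃ G, (1 - T) * G = 1 ∧ G * (1 - T) = 1 ∧ HasLevel w 0 G := by
  let N : n → n → ℤ → ℕ := fun a b m => (w a - w b - 2 * m + 1).toNat
  have hN : ∀ a b m (j : ℕ), N a b m ≤ j → j * k + w a - w b < 2 * m := by
    intro a b m j hj
    have : w a - w b - 2 * m + 1 ≤ j := by simp only [N] at hj; lia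
    nlinarith [Int.natCast_nonneg j]
  let P : ℕ → Matrix n n (PsiDO V) := fun N => ∑ j ∈ Finset.range N, T ^ j
  have hP : ∀ N, HasLevel w 0 (P N) := fun N => HasLevel.sum _ fun j _ =>
    (hT.pow j).mono (by nlinarith [Int.natCast_nonneg j])
  -- the coefficients of the partial sums are eventually constant
  have hstab : ∀ a b m (i j : ℕ), i ≤ j → i * k + w a - w b < 2 * m →
      (P j a b).coeff m = (P i a b).coeff m := by
    intro a b m i j hij hi
    have : P j = P i + ∑ l ∈ Finset.Ico i j, T ^ l :=
      (Finset.sum_range_add_sum_Ico _ hij).symm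
    rw [this, Matrix.add_apply, coeff_add, add_eq_left]
    refine HasLevel.sum (w := w) (k := i * k) _ (fun l hl => (hT.pow l).mono ?_) a b m hi
    have : (i : ℤ) ≤ l := by exact_mod_cast (Finset.mem_Ico.mp hl).1
    nlinarith
  let G : Matrix n n (PsiDO V) := Matrix.of fun a b =>
    ⟨fun m => (P (N a b m) a b).coeff m, |w a - w b|, fun m hm => hP _ a b m (by
      have := le_abs_self (w a - w b)
      have := abs_nonneg (w a - w b)
      lia)⟩
  have hG : ∀ a b m, (G a b).coeff m = (P (N a b m) a b).coeff m := fun _ _ _ => rfl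
  have hGP : ∀ j : ℕ, HasLevel w (j * k) (G - P j) := by
    intro j a b m hm
    rw [Matrix.sub_apply, coeff_sub, hG, sub_eq_zero]
    rcases le_total j (N a b m) with h | h
    · exact hstab a b m j _ h hm
    · exact (hstab a b m _ j h (hN a b m _ le_rfl)).symm
  have hG0 : HasLevel w 0 G := fun a b m hm => hP _ a b m hm
  have h1 : HasLevel w 0 (1 - T) := by
    rw [sub_eq_add_neg]; exact hasLevel_one.add (hT.neg.mono hk.le)
  refine ⟨G, ?_, ?_, hG0⟩
  · refine sub_eq_zero.mp (eq_zero_of_hasLevel hk (w := w) fun j => ?_)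
    have : (1 - T) * G - 1 = (1 - T) * (G - P j) + -(T ^ j) := by
      rw [mul_sub, mul_neg_geom_sum]; abel
    rw [this]
    exact HasLevel.add (by simpa using h1.mul (hGP j)) (hT.pow j).neg
  · refine sub_eq_zero.mp (eq_zero_of_hasLevel hk (w := w) fun j => ?_)
    have : G * (1 - T) - 1 = (G - P j) * (1 - T) + -(T ^ j) := by
      rw [sub_mul, geom_sum_mul_neg]; abel
    rw [this]
    exact HasLevel.add (by simpa using (hGP j).mul h1) (hT.pow j).neg

theorem isUnit_one_sub {w : n → ℤ} {k : ℤ} (hk : k < 0) {T : Matrix n n (PsiDO V)}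
    (hT : HasLevel w k T) : IsUnit (1 - T) := by
  obtain ⟨G, h1, h2, -⟩ := exists_inverse_one_sub hk hT
  exact ⟨⟨1 - T, G, h1, h2⟩, rfl⟩

end Level

/-- An operator whose leading coefficient is a unit is invertible. -/
theorem isUnit_of_orderLE {a : PsiDO V} {k : ℤ} (ha : OrderLE k a) (hu : IsUnit (a.coeff k)) :
    IsUnit a := by
  obtain ⟨u, hu⟩ := hu
  have h1 : IsUnit (const (↑u⁻¹ : V)) := (u⁻¹.isUnit).map (constHom V)
  suffices h : IsUnit (const (↑u⁻¹ : V) * a * monomial (-k) 1) by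
    rw [IsUnit.mul_right_iff (isUnit_monomial_one (-k)), h1.mul_left_iff] at h
    exact h
  set b := const (↑u⁻¹ : V) * a * monomial (-k) 1 with hb
  let T : Matrix Unit Unit (PsiDO V) := Matrix.of fun _ _ => 1 - b
  have hT : HasLevel (fun _ => 0) (-1) T := by
    intro _ _ m hm
    change (1 - b).coeff m = 0
    rw [coeff_sub, hb, coeff_mul_monomial_one, const_mul_coeff, coeff_one]
    split_ifs with h
    · rw [h, show 0 - -k = k by ring, ← hu, Units.inv_mul, sub_self]
    · rw [ha _ (by lia), mul_zero, sub_self]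
  obtain ⟨G, h1, h2, -⟩ := exists_inverse_one_sub (by lia) hT
  have e1 := congrFun (congrFun h1 ()) ()
  have e2 := congrFun (congrFun h2 ()) ()
  simp only [Matrix.mul_apply, Finset.univ_unique, Finset.sum_singleton, Matrix.sub_apply,
    Matrix.one_apply_eq, T, Matrix.of_apply, sub_sub_cancel] at e1 e2
  exact ⟨⟨b, _, e1, e2⟩, rfl⟩

end PsiDO

/-! ### Matrices of pseudodifferential operators over a differential field -/

theorem Matrix.isUnit_of_vecMul_eq_zero {D n : Type*} [DivisionRing D] [Fintype n] [DecidableEq n]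
    {M : Matrix n n D} (h : ∀ v : n → D, v ᵥ* M = 0 → v = 0) : IsUnit M := by
  have hinj : Function.Injective M.vecMulLinear :=
    (injective_iff_map_eq_zero _).mpr h
  have hsurj := LinearMap.surjective_of_injective hinj
  choose N hN using fun i => hsurj (Pi.single i 1)
  have h1 : Matrix.of N * M = 1 := by
    ext i j
    have := congrFun (hN i) j
    rw [Matrix.vecMulLinear_apply] at this
    rw [Matrix.mul_apply_eq_vecMul, Matrix.one_apply]
    change (N i ᵥ* M) j = _
    rw [this, Pi.single_apply]
    simp only [eq_comm]
  exact ⟨⟨M, Matrix.of N, mul_eq_one_symm h1, h1⟩, rfl⟩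

theorem IsUnit.eq_zero_of_vecMul_eq_zero {R n : Type*} [Ring R] [Fintype n] [DecidableEq n]
    {M : Matrix n n R} (hM : IsUnit M) {v : n → R} (h : v ᵥ* M = 0) : v = 0 := by
  obtain ⟨u, rfl⟩ := hM
  rw [← Matrix.vecMul_one v, ← u.mul_inv, ← Matrix.vecMul_vecMul, h, Matrix.zero_vecMul]

namespace PsiDO

section Field

variable {K : Type*} [Field K] [Differential K]

/-- A nonzero vector of operators has a largest order of its components. -/
theorem exists_order {V : Type*} [CommRing V] {n : Type*} [Finite n] {v : n → PsiDO V}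
    (hv : v ≠ 0) : ∃ N : ℤ, (∀ i, OrderLE N (v i)) ∧ ∃ i, (v i).coeff N ≠ 0 := by
  choose B hB using fun i => (v i).exists_bound
  obtain ⟨C, hC⟩ := (Set.finite_range B).bddAbove
  have hC' : ∀ i, B i ≤ C := fun i => hC ⟨i, rfl⟩
  obtain ⟨N, ⟨i, hi⟩, hN⟩ := Int.exists_greatest_of_bdd (P := fun m => ∃ i, (v i).coeff m ≠ 0)
    ⟨C, fun m ⟨i, hi⟩ => by
      by_contra hc
      exact hi (hB i m (by have := hC' i; lia))⟩ (by
      by_contra! hc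
      exact hv (funext fun i => ext fun m => hc m i))
  refine ⟨N, fun i m hm => ?_, i, hi⟩
  by_contra hc
  exact absurd (hN m ⟨i, hc⟩) (by lia)

theorem isUnit_or_eq_zero (a : PsiDO K) : IsUnit a ∨ a = 0 := by
  rw [or_iff_not_imp_right]
  intro ha
  obtain ⟨N, h1, -, h2⟩ := exists_order (v := fun _ : Unit => a) (fun h => ha (congrFun h ()))
  exact isUnit_of_orderLE (h1 ()) (isUnit_iff_ne_zero.mpr h2)

instance : Nontrivial (PsiDO K) :=
  ⟨0, 1, fun h => by simpa [coeff_one] using congrArg (fun a => a.coeff 0) h⟩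

/-- The pseudodifferential operators over a differential field form a division ring. -/
noncomputable abbrev divisionRing : DivisionRing (PsiDO K) :=
  DivisionRing.ofIsUnitOrEqZero isUnit_or_eq_zero

theorem isUnit_matrix_of_vecMul_eq_zero {n : Type*} [Fintype n] [DecidableEq n]
    {M : Matrix n n (PsiDO K)} (h : ∀ v : n → PsiDO K, v ᵥ* M = 0 → v = 0) : IsUnit M :=
  letI := divisionRing (K := K)
  Matrix.isUnit_of_vecMul_eq_zero h

/-- A matrix of operators over a differential subfield which is invertible over the larger field
is invertible over the subfield. -/
theorem isUnit_of_isUnit_map {K' : Type*} [Field K'] [Differential K'] (φ : K →+* K')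
    (hφ : ∀ v, φ v′ = (φ v)′) {n : Type*} [Fintype n] [DecidableEq n] {M : Matrix n n (PsiDO K)}
    (h : IsUnit ((mapHom φ hφ).mapMatrix M)) : IsUnit M := by
  refine isUnit_matrix_of_vecMul_eq_zero fun v hv => ?_
  have h0 : (mapHom φ hφ ∘ v) ᵥ* (mapHom φ hφ).mapMatrix M = 0 := by
    funext j
    rw [RingHom.mapMatrix_apply, ← RingHom.map_vecMul, hv, Pi.zero_apply, map_zero, Pi.zero_apply]
  have := h.eq_zero_of_vecMul_eq_zero h0
  funext i
  ext m
  have h1 := congrArg (fun a => a.coeff m) (congrFun this i)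
  simpa [mapHom_apply] using h1

/-- If a matrix of operators over `V` becomes the identity under a homomorphism of differential
rings `ψ`, it is invertible over every differential field containing `V`. If `v` is a nonzero row
vector killed by it, so are the `∂⁻ᵏ v`. A suitable linear combination `a • v` of them has vanishing
coefficients in a prescribed range of orders; its coefficients of higher order then satisfy a
square linear system over `V` whose determinant is mapped to `1` by `ψ`, so they vanish too. This
contradicts the order of `a • v`. -/
theorem isUnit_map_of_map_eq_one {V V' : Type*} [CommRing V] [Differential V] [CommRing V']
    [Nontrivial V'] [Differential V'] (ι : V →+* K) (hinj : Function.Injective ι)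
    (hι : ∀ v, ι v′ = (ι v)′) (ψ : V →+* V') (hψ : ∀ v, ψ v′ = (ψ v)′)
    {n : Type*} [Fintype n] [DecidableEq n] {M : Matrix n n (PsiDO V)}
    (hM : (mapHom ψ hψ).mapMatrix M = 1) : IsUnit ((mapHom ι hι).mapMatrix M) := by
  refine isUnit_matrix_of_vecMul_eq_zero fun v hv => ?_
  by_contra hv0
  obtain ⟨N, hN, i₀, hi₀⟩ := exists_order hv0
  obtain ⟨e, he⟩ : ∃ e : ℕ, ∀ i j, OrderLE e (M i j) := by
    choose B hB using fun x : n × n => (M x.1 x.2).exists_bound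
    obtain ⟨C, hC⟩ := (Set.finite_range B).bddAbove
    refine ⟨C.toNat, fun i j m hm => hB (i, j) m ?_⟩
    have : B (i, j) ≤ C := hC ⟨(i, j), rfl⟩
    lia
  set MK := (mapHom ι hι).mapMatrix M with hMK
  have heK : ∀ i j, OrderLE e (MK i j) := fun i j m hm => by
    simp [hMK, mapHom_apply, he i j m hm]
  -- `p + e` vectors have more linear combinations than the `card n * e` conditions needed to
  -- annihilate the coefficients of `e` consecutive orders
  obtain ⟨p, hp⟩ : ∃ p : ℕ, Fintype.card n * e < p + e :=
    ⟨Fintype.card n * e + 1, by lia⟩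
  -- the action of `M` on the coefficients of the orders `0, …, -(p - 1)`
  let T : Matrix (n × Fin p) (n × Fin p) V := Matrix.of fun a b =>
    (monomial (-(a.2 : ℤ)) 1 * M a.1 b.1).coeff (-(b.2 : ℤ))
  have hT : (ι.mapMatrix T).det ≠ 0 := by
    have h1 : ψ.mapMatrix T = 1 := by
      ext ⟨i, k⟩ ⟨j, l⟩
      have h2 := congrFun (congrFun hM i) j
      rw [RingHom.mapMatrix_apply, Matrix.map_apply] at h2
      change ψ ((monomial (-(k : ℤ)) 1 * M i j).coeff (-(l : ℤ))) = _
      rw [← coeff_map, ← mapHom_apply ψ hψ, map_mul, h2, mapHom_apply, map_monomial, map_one,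
        Matrix.one_apply, Matrix.one_apply]
      by_cases hij : i = j
      · simp [hij, coeff_monomial, Fin.ext_iff, eq_comm]
      · simp [hij]
    rw [← RingHom.map_det, map_ne_zero_iff ι hinj]
    intro h0
    have := congrArg ψ h0
    rw [RingHom.map_det, h1, Matrix.det_one, map_zero] at this
    exact one_ne_zero this
  obtain ⟨c, hc, hc0⟩ : ∃ c : Fin (p + e) → K, (∀ i, ∀ l : Fin e,
      ∑ k, c k * (monomial (-(k : ℤ) - N) 1 * v i).coeff (-(p + l : ℤ)) = 0) ∧ c ≠ 0 := by
    let L : (Fin (p + e) → K) →ₗ[K] (n × Fin e → K) := (Matrix.of fun k a =>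
      (monomial (-((k : Fin (p + e)) : ℤ) - N) 1 * v a.1).coeff
        (-(p + (a.2 : Fin e) : ℤ))).vecMulLinear
    have hL : LinearMap.ker L ≠ ⊥ := LinearMap.ker_ne_bot_of_finrank_lt (by
      simp only [Module.finrank_fintype_fun_eq_card, Fintype.card_prod, Fintype.card_fin]
      exact hp)
    obtain ⟨c, hc, hc0⟩ := (Submodule.ne_bot_iff _).mp hL
    exact ⟨c, fun i l => congrFun (LinearMap.mem_ker.mp hc) (i, l), hc0⟩
  let a : PsiDO K := ∑ k : Fin (p + e), const (c k) * monomial (-(k : ℤ) - N) 1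
  have hw : (a • v) ᵥ* MK = 0 := by rw [Matrix.smul_vecMul, hv, smul_zero]
  have hwc : ∀ i m, ((a • v) i).coeff m =
      ∑ k : Fin (p + e), c k * (monomial (-(k : ℤ) - N) 1 * v i).coeff m := by
    intro i m
    rw [Pi.smul_apply, smul_eq_mul, Finset.sum_mul, coeff_sum]
    exact Finset.sum_congr rfl fun k _ => by rw [mul_assoc, const_mul_coeff]
  have hw0 : ∀ i, OrderLE 0 ((a • v) i) := by
    intro i m hm
    rw [hwc]
    refine Finset.sum_eq_zero fun k _ => ?_
    rw [((orderLE_monomial _ _).mul (hN i)) m (by lia), mul_zero]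
  -- `Q` is the part of `a • v` of order greater than `-p`, with coefficients `d`
  let d : n × Fin p → K := fun x => ((a • v) x.1).coeff (-(x.2 : ℤ))
  let Q : n → PsiDO K := fun i => ∑ k : Fin p, const (d (i, k)) * monomial (-(k : ℤ)) 1
  have hR : ∀ i, OrderLE (-(p + e : ℤ)) ((a • v) i - Q i) := by
    intro i m hm
    have hQ : (Q i).coeff m = ∑ k : Fin p, if m = -(k : ℤ) then d (i, k) else 0 := by
      rw [coeff_sum]
      exact Finset.sum_congr rfl fun k _ => by rw [const_mul_coeff, coeff_monomial]; simp
    rw [coeff_sub, hQ, sub_eq_zero]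
    rcases lt_or_ge 0 m with h0 | h0
    · rw [hw0 i m h0, Finset.sum_eq_zero fun k _ => if_neg (by lia)]
    obtain ⟨k, rfl⟩ : ∃ k : ℕ, m = -(k : ℤ) := ⟨m.natAbs, by lia⟩
    by_cases hk : k < p
    · rw [Finset.sum_eq_single (⟨k, hk⟩ : Fin p)]
      · simp [d]
      · intro l _ hl
        exact if_neg fun h => hl (Fin.ext (by simp only; lia))
      · simp
    · rw [hwc, Finset.sum_eq_zero (s := Finset.univ (α := Fin p)) fun l _ =>
        if_neg (by have := l.isLt; lia)]
      have := hc i ⟨k - p, by lia⟩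
      rwa [show (-(p + ((k - p : ℕ) : ℤ)) : ℤ) = -(k : ℤ) by lia] at this
  have hd : d ᵥ* ι.mapMatrix T = 0 := by
    funext ⟨j, l⟩
    have h1 := congrArg (fun b => b.coeff (-(l : ℤ))) (congrFun hw j)
    simp only [Matrix.vecMul, dotProduct, Pi.zero_apply, coeff_zero, coeff_sum] at h1
    rw [Pi.zero_apply, ← h1, Matrix.vecMul, dotProduct, Fintype.sum_prod_type]
    refine Finset.sum_congr rfl fun i _ => ?_
    have h2 : ((a • v) i * MK i j).coeff (-(l : ℤ)) = (Q i * MK i j).coeff (-(l : ℤ)) := by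
      rw [← sub_eq_zero, ← coeff_sub, ← sub_mul]
      exact ((hR i).mul (heK i j)) _ (by have := l.isLt; lia)
    rw [h2, Finset.sum_mul, coeff_sum]
    refine Finset.sum_congr rfl fun k _ => ?_
    rw [mul_assoc, const_mul_coeff]
    congr 1
    change ι ((monomial (-(k : ℤ)) 1 * M i j).coeff (-(l : ℤ))) = _
    rw [← coeff_map, ← mapHom_apply ι hι, map_mul, mapHom_apply, map_monomial, map_one]
    rfl
  have hd0 : d = 0 := Matrix.eq_zero_of_vecMul_eq_zero hT hd
  have hsmall : ∀ i, OrderLE (-(p + e : ℤ)) ((a • v) i) := by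
    intro i
    have hQ : Q i = 0 := Finset.sum_eq_zero fun k _ => by
      rw [hd0, Pi.zero_apply, ← constHom_apply, map_zero, zero_mul]
    simpa [hQ] using hR i
  -- the leading term of `a • v` comes from the first nonzero coefficient of the linear combination
  have hac : ∀ m, a.coeff m = ∑ k : Fin (p + e), if m = -(k : ℤ) - N then c k else 0 := by
    intro m
    rw [coeff_sum]
    exact Finset.sum_congr rfl fun k _ => by rw [const_mul_coeff, coeff_monomial]; simp
  classical
  obtain ⟨k₁, hk₁⟩ := Function.ne_iff.mp hc0
  obtain ⟨k₀, hk₀, hmin⟩ := (Finset.univ.filter fun k => c k ≠ 0).exists_min_image id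
    ⟨k₁, by simpa using hk₁⟩
  simp only [Finset.mem_filter, Finset.mem_univ, true_and, id] at hk₀ hmin
  have ha : OrderLE (-(k₀ : ℤ) - N) a := by
    intro m hm
    rw [hac]
    refine Finset.sum_eq_zero fun k _ => ?_
    split_ifs with h
    · by_contra hck
      have : (k₀ : ℕ) ≤ (k : ℕ) := hmin k hck
      omega
    · rfl
  have htop := coeff_mul_top ha (hN i₀)
  rw [hac, Finset.sum_eq_single k₀, if_pos rfl] at htop
  · refine mul_ne_zero hk₀ hi₀ (htop.symm.trans (hsmall i₀ _ ?_))
    have := k₀.isLt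
    omega
  · intro k _ hk
    exact if_neg fun h => hk (Fin.ext (by lia))
  · simp

end Field

end PsiDO

/-! ### Differential polynomials and the `λ`-bracket -/

section LamDel

variable {V : Type*} [CommRing V] [Differential V]

theorem lamDel_apply (p : V[X]) : lamDel p = Polynomial.X * p + Differential.mapCoeffs p := rfl

theorem lamDel_C_mul (v : V) (p : V[X]) :
    lamDel (Polynomial.C v * p) = Polynomial.C v * lamDel p + Polynomial.C v′ * p := by
  rw [lamDel_apply, lamDel_apply, Derivation.leibniz, Differential.mapCoeffs_C, smul_eq_mul,
    smul_eq_mul]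
  ring

theorem map_mapCoeffs {V' : Type*} [CommRing V'] [Differential V'] (φ : V →+* V')
    (hφ : ∀ v, φ v′ = (φ v)′) (p : V[X]) :
    (Differential.mapCoeffs p).map φ = Differential.mapCoeffs (p.map φ) := by
  ext n
  simp [hφ]

theorem map_lamDel {V' : Type*} [CommRing V'] [Differential V'] (φ : V →+* V')
    (hφ : ∀ v, φ v′ = (φ v)′) (p : V[X]) :
    (lamDel p).map φ = lamDel (p.map φ) := by
  simp [lamDel_apply, map_mapCoeffs φ hφ]

theorem lamDel_pow_C {v : V} (hv : v′ = 0) (k : ℕ) :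
    (lamDel ^ k) (Polynomial.C v) = Polynomial.C v * Polynomial.X ^ k := by
  induction k with
  | zero => simp
  | succ k ih =>
    rw [pow_succ', Module.End.mul_apply, ih, lamDel_apply, Derivation.leibniz,
      Differential.mapCoeffs_C, hv, Derivation.leibniz_pow, Differential.mapCoeffs_X]
    simp only [smul_zero, map_zero, add_zero]
    ring

end LamDel

namespace DiffPoly

variable {F : Type*} [Field F] {ι : Type*}

theorem deriv_C (c : F) : (MvPolynomial.C c : DiffPoly ι F)′ = 0 :=
  Derivation.map_algebraMap (MvPolynomial.mkDerivation F
    (fun v : ι × ℕ => (MvPolynomial.X (v.1, v.2 + 1) : DiffPoly ι F))) c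

theorem deriv_X (i : ι) (n : ℕ) :
    (MvPolynomial.X (i, n) : DiffPoly ι F)′ = MvPolynomial.X (i, n + 1) :=
  MvPolynomial.mkDerivation_X _ _ _

theorem iterDeriv_X (i : ι) (n : ℕ) :
    PsiDO.iterDeriv n (MvPolynomial.X (i, 0) : DiffPoly ι F) = MvPolynomial.X (i, n) := by
  induction n with
  | zero => rfl
  | succ n ih => rw [PsiDO.iterDeriv_succ, ih, deriv_X]

/-- An algebra homomorphism commuting with the derivation on the variables is a homomorphism of
differential rings. -/
theorem map_deriv {A : Type*} [CommRing A] [Algebra F A] [Differential A]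
    (hA : ∀ c : F, (algebraMap F A c)′ = 0) (φ : DiffPoly ι F →ₐ[F] A)
    (hφ : ∀ i n, φ (MvPolynomial.X (i, n + 1)) = (φ (MvPolynomial.X (i, n)))′)
    (v : DiffPoly ι F) : φ v′ = (φ v)′ := by
  induction v using MvPolynomial.induction_on with
  | C c =>
    rw [deriv_C, map_zero, ← MvPolynomial.algebraMap_eq, AlgHom.commutes, hA]
  | add u v hu hv => rw [map_add, map_add, hu, hv, map_add, map_add]
  | mul_X u i hu =>
    rw [Derivation.leibniz, deriv_X, map_add, smul_eq_mul, smul_eq_mul, map_mul, map_mul, hφ, hu,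
      map_mul, Derivation.leibniz, smul_eq_mul, smul_eq_mul]

theorem lambdaBracket_X (G : ι → ι → Polynomial (DiffPoly ι F)) (f : DiffPoly ι F) (i : ι)
    (n : ℕ) : lambdaBracket G f (MvPolynomial.X (i, n)) = (lamDel ^ n) (lambdaBracketGen G f i) :=
  MvPolynomial.mkDerivation_X _ _ _

/-- Sesquilinearity of the `λ`-bracket in its second argument. -/
theorem lambdaBracket_deriv (G : ι → ι → Polynomial (DiffPoly ι F)) (f v : DiffPoly ι F) :
    lambdaBracket G f v′ = lamDel (lambdaBracket G f v) := by
  induction v using MvPolynomial.induction_on with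
  | C c =>
    rw [deriv_C, ← MvPolynomial.algebraMap_eq, Derivation.map_algebraMap, map_zero, map_zero]
  | add u v hu hv => rw [map_add, map_add, hu, hv, map_add, map_add]
  | mul_X u i hu =>
    obtain ⟨i, n⟩ := i
    rw [Derivation.leibniz, deriv_X, map_add, smul_eq_mul, smul_eq_mul, Derivation.leibniz,
      Derivation.leibniz, Derivation.leibniz, hu, lambdaBracket_X, lambdaBracket_X]
    simp only [Polynomial.smul_eq_C_mul, map_add, lamDel_C_mul, deriv_X, pow_succ',
      Module.End.mul_apply]
    ring

end DiffPoly

/-! ### Gauge transformations -/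

section Gauge

variable {V : Type*} [CommRing V]

/-- The ring `V[λ] ⊕ V[λ] δ` with `δ² = 0`. Its derivation is the derivation of the coefficients on
`V[λ]`, and `δ' = λ δ`. -/
abbrev GaugeRing (V : Type*) [CommRing V] : Type _ := TrivSqZeroExt V[X] V[X]

/-- The inclusion `V ⊆ V[λ] ⊕ V[λ] δ`. -/
noncomputable def gaugeIncl (V : Type*) [CommRing V] : V →+* GaugeRing V :=
  (TrivSqZeroExt.inlHom V[X] V[X]).comp Polynomial.C

theorem gaugeIncl_apply (v : V) : gaugeIncl V v = TrivSqZeroExt.inl (Polynomial.C v) := rfl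

/-- The homomorphism `v ↦ v + D(v) δ` attached to a derivation `D : V → V[λ]`. -/
noncomputable def gaugeHom (D : V →+ V[X])
    (hD : ∀ u v, D (u * v) = Polynomial.C u * D v + Polynomial.C v * D u) : V →+* GaugeRing V where
  toFun v := TrivSqZeroExt.inl (Polynomial.C v) + TrivSqZeroExt.inr (D v)
  map_zero' := by simp
  map_one' := by
    have : D 1 = 0 := by simpa using hD 1 1
    simp [this]
  map_add' u v := by ext <;> simp
  map_mul' u v := by
    ext1
    · simp
    · simp [hD, mul_comm]

theorem gaugeHom_apply (D : V →+ V[X])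
    (hD : ∀ u v, D (u * v) = Polynomial.C u * D v + Polynomial.C v * D u) (v : V) :
    gaugeHom D hD v = TrivSqZeroExt.inl (Polynomial.C v) + TrivSqZeroExt.inr (D v) := rfl

theorem gaugeHom_eq_gaugeIncl_iff (D : V →+ V[X])
    (hD : ∀ u v, D (u * v) = Polynomial.C u * D v + Polynomial.C v * D u) (v : V) :
    gaugeHom D hD v = gaugeIncl V v ↔ D v = 0 := by
  rw [gaugeHom_apply, gaugeIncl_apply, add_eq_left]
  constructor
  · intro h; simpa using congrArg TrivSqZeroExt.snd h
  · intro h; simp [h]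

variable [Differential V]

noncomputable instance GaugeRing.instDifferential : Differential (GaugeRing V) :=
  differentialOfLeibniz
    { toFun := fun x => TrivSqZeroExt.inl (Differential.mapCoeffs x.fst) +
        TrivSqZeroExt.inr (lamDel x.snd)
      map_zero' := by simp
      map_add' := fun x y => by ext <;> simp }
    (by
      intro a b
      ext1
      · simp
      · simp [lamDel_apply]
        ring)

theorem GaugeRing.deriv_eq (x : GaugeRing V) :
    x′ = TrivSqZeroExt.inl (Differential.mapCoeffs x.fst) + TrivSqZeroExt.inr (lamDel x.snd) := rfl

theorem gaugeIncl_deriv (v : V) : gaugeIncl V v′ = (gaugeIncl V v)′ := by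
  simp [gaugeIncl_apply, GaugeRing.deriv_eq]

theorem gaugeHom_deriv (D : V →+ V[X])
    (hD : ∀ u v, D (u * v) = Polynomial.C u * D v + Polynomial.C v * D u)
    (hD' : ∀ v, D v′ = lamDel (D v)) (v : V) : gaugeHom D hD v′ = (gaugeHom D hD v)′ := by
  simp [gaugeHom_apply, GaugeRing.deriv_eq, hD']

end Gauge

namespace Pyramid

variable {F : Type*} [Field F] {P : Pyramid}

/-! ### The grading -/

/-- Twice the eigenvalue of `x` on the basis vector of a box. -/
def wt (a : P.Box) : ℤ := (P.p a.1 : ℤ) - 1 - 2 * ((a.2 : ℕ) : ℤ)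

theorem xCoord_eq (a : P.Box) : xCoord a = (wt a : ℚ) / 2 := by
  rw [xCoord, wt]
  push_cast
  ring

theorem xCoord_sub_le_half_iff (a b : P.Box) : xCoord a - xCoord b ≤ 1 / 2 ↔ wt a - wt b ≤ 1 := by
  rw [xCoord_eq, xCoord_eq, ← sub_div, div_le_div_iff_of_pos_right (by norm_num)]
  exact_mod_cast Iff.rfl

theorem wt_le (a : P.Box) : wt a ≤ P.p 0 - 1 := by
  have : P.p a.1 ≤ P.p 0 := P.p_anti (Fin.zero_le _)
  rw [wt]
  lia

theorem le_wt (a : P.Box) : 1 - (P.p 0 : ℤ) ≤ wt a := by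
  have : P.p a.1 ≤ P.p 0 := P.p_anti (Fin.zero_le _)
  have := a.2.isLt
  rw [wt]
  lia

theorem wt_firstBox (i : P.TopRow) : wt (P.firstBox i) = P.p 0 - 1 := by
  have := i.2
  simp [wt, firstBox, this]

theorem wt_lastBox (i : P.TopRow) : wt (P.lastBox i) = 1 - P.p 0 := by
  have := i.2
  have := P.p_pos 0
  simp only [wt, lastBox]
  lia

theorem wt_of_nil_ne_zero {a b : P.Box} (h : P.nil F a b ≠ 0) : wt a = wt b - 2 := by
  simp only [nil, Matrix.of_apply, ne_eq, ite_eq_right_iff, one_ne_zero, imp_false, not_not] at h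
  obtain ⟨i, k⟩ := a
  obtain ⟨j, l⟩ := b
  obtain ⟨h1, h2⟩ := h
  simp only at h1 h2
  subst h1
  simp only [wt, h2]
  push_cast
  ring

theorem xCoord_of_mem_gPart [CharZero F] {k : ℚ} {m : P.Gl F} (hm : m ∈ P.gPart F k) {a b : P.Box}
    (h : m a b ≠ 0) : xCoord a - xCoord b = k := by
  have h1 : ⁅P.xMat F, m⁆ = (k : F) • m := hm
  have h2 := congrFun (congrFun h1 a) b
  rw [Ring.lie_def, xMat, Matrix.sub_apply, Matrix.diagonal_mul, Matrix.mul_diagonal,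
    Matrix.smul_apply, smul_eq_mul, mul_comm (m a b), ← sub_mul] at h2
  exact_mod_cast mul_right_cancel₀ h h2

theorem wt_of_mem_gGeHalf [CharZero F] {m : P.Gl F} (hm : m ∈ P.gGeHalf F) {a b : P.Box}
    (h : m a b ≠ 0) : wt b + 1 ≤ wt a := by
  have hle : P.gGeHalf F ≤
      ({ carrier := {m | ∀ a b : P.Box, wt a ≤ wt b → m a b = 0}
         zero_mem' := fun _ _ _ => rfl
         add_mem' := fun hu hv a b hab => by
          rw [Matrix.add_apply, hu a b hab, hv a b hab, add_zero]
         smul_mem' := fun c u hu a b hab => by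
          rw [Matrix.smul_apply, hu a b hab, smul_zero] } : Submodule F (P.Gl F)) := by
    refine iSup₂_le fun k hk u hu a b hab => ?_
    by_contra hne
    have h1 := xCoord_of_mem_gPart hu hne
    rw [xCoord_eq, xCoord_eq, ← sub_div] at h1
    have h2 : ((wt a : ℤ) : ℚ) ≤ wt b := by exact_mod_cast hab
    linarith
  by_contra hc
  exact h (hle hm a b (by lia))

theorem wt_of_mem_gPart_depth [CharZero F] {m : P.Gl F} (hm : m ∈ P.gPart F P.depth)
    {a b : P.Box} (h : m a b ≠ 0) : wt a - wt b = 2 * (P.p 0 - 1) := by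
  have h1 := xCoord_of_mem_gPart hm h
  rw [xCoord_eq, xCoord_eq, ← sub_div, depth, div_eq_iff (by norm_num)] at h1
  have h2 : (((wt a - wt b : ℤ)) : ℚ) = ((2 * (P.p 0 - 1) : ℤ) : ℚ) := by
    push_cast
    linarith
  exact_mod_cast h2

theorem mul_eq_zero_of_depth [CharZero F] {S m : P.Gl F} (hS : S ∈ P.gPart F P.depth)
    (hm : m ∈ P.gGeHalf F) : S * m = 0 ∧ m * S = 0 := by
  constructor
  all_goals
    ext a b
    rw [Matrix.mul_apply]
    refine Finset.sum_eq_zero fun c _ => ?_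
    by_contra h
    rw [mul_eq_zero, not_or] at h
    have := wt_le a
    have := le_wt b
  · have := wt_of_mem_gPart_depth hS h.1
    have := wt_of_mem_gGeHalf hm h.2
    lia
  · have := wt_of_mem_gPart_depth hS h.2
    have := wt_of_mem_gGeHalf hm h.1
    lia

/-! ### The homomorphism `ρ` and the brackets defining `𝒲` -/

theorem rhoGen_of_le {u : P.Box × P.Box} (h : xCoord u.1 - xCoord u.2 ≤ 1 / 2) :
    (rhoGen u : P.VLow F) = MvPolynomial.X (⟨u, h⟩, 0) := by
  have h1 : Matrix.trace (P.nil F * P.elem F u) = 0 := by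
    rw [elem, Matrix.trace_mul_single, MulOpposite.op_one, one_smul]
    by_contra hc
    have := wt_of_nil_ne_zero hc
    rw [xCoord_sub_le_half_iff] at h
    lia
  rw [rhoGen, dif_pos h, h1, map_zero, add_zero]

theorem rhoGen_of_lt {u : P.Box × P.Box} (h : 1 < wt u.1 - wt u.2) :
    (rhoGen u : P.VLow F) = MvPolynomial.C (P.nil F u.2 u.1) := by
  rw [rhoGen, dif_neg (by rw [xCoord_sub_le_half_iff]; lia), zero_add, elem,
    Matrix.trace_mul_single, MulOpposite.op_one, one_smul]

theorem rho_X (u : P.Box × P.Box) (n : ℕ) :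
    rho (MvPolynomial.X (u, n) : P.VG F) = PsiDO.iterDeriv n (rhoGen u) :=
  MvPolynomial.aeval_X _ _

theorem deriv_algebraMap_vLow (c : F) : (algebraMap F (P.VLow F) c)′ = 0 :=
  DiffPoly.deriv_C c

theorem rho_deriv (v : P.VG F) : rho v′ = (rho v)′ := by
  have h : ∀ i n, (rho : P.VG F →ₐ[F] P.VLow F) (MvPolynomial.X (i, n + 1)) =
      (rho (MvPolynomial.X (i, n) : P.VG F))′ := fun i n => by
    rw [rho_X, rho_X, PsiDO.iterDeriv_succ]
  have := DiffPoly.map_deriv deriv_algebraMap_vLow rho h v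
  exact this

theorem incl_X (u : P.LowIdx) (n : ℕ) :
    incl (MvPolynomial.X (u, n) : P.VLow F) = MvPolynomial.X (u.1, n) :=
  MvPolynomial.rename_X _ _

theorem incl_deriv (v : P.VLow F) : incl v′ = (incl v)′ := by
  have h : ∀ i n, (incl : P.VLow F →ₐ[F] P.VG F) (MvPolynomial.X (i, n + 1)) =
      (incl (MvPolynomial.X (i, n) : P.VLow F))′ := fun i n => by
    rw [incl_X, incl_X, DiffPoly.deriv_X]
  have h0 : ∀ c : F, (algebraMap F (P.VG F) c)′ = 0 := fun c => DiffPoly.deriv_C c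
  have := DiffPoly.map_deriv h0 incl h v
  exact this

theorem rho_incl (v : P.VLow F) : rho (incl v) = v := by
  have : (rho.comp incl : P.VLow F →ₐ[F] P.VLow F) = AlgHom.id F _ := by
    ext ⟨u, n⟩
    rw [AlgHom.comp_apply, incl_X, rho_X, rhoGen_of_le u.2, DiffPoly.iterDeriv_X]
    rfl
  exact congrArg (fun φ => φ v) this

theorem q_elem (u : P.Box × P.Box) : q (P.elem F u) = MvPolynomial.X (u, 0) := by
  rw [q, Finset.sum_eq_single u]
  · simp [elem]
  · intro v _ hv
    rw [elem, Matrix.single_apply_of_ne, zero_smul]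
    rintro ⟨h1, h2⟩
    exact hv (Prod.ext h1.symm h2.symm)
  · simp

theorem q_add (m m' : P.Gl F) : q (m + m') = q m + q m' := by
  simp only [q, Matrix.add_apply, add_smul, Finset.sum_add_distrib]

theorem q_smul (c : F) (m : P.Gl F) : q (c • m) = c • q m := by
  simp only [q, Matrix.smul_apply, smul_assoc, Finset.smul_sum]

theorem rho_q (m : P.Gl F) : rho (q m) = ∑ u : P.Box × P.Box, m u.1 u.2 • rhoGen u := by
  rw [q, map_sum]
  exact Finset.sum_congr rfl fun u _ => by rw [map_smul, rho_X, PsiDO.iterDeriv_zero]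

theorem rho_q_elem (u : P.Box × P.Box) : rho (q (P.elem F u)) = rhoGen u := by
  rw [q_elem, rho_X, PsiDO.iterDeriv_zero]

variable (F P) in
/-- The matrix `ρ(Q)`. -/
noncomputable def rhoQ : Matrix P.Box P.Box (P.VLow F) := Matrix.of fun a b => rhoGen (b, a)

theorem rho_q_lie (m : P.Gl F) (a b : P.Box) :
    rho (q ⁅m, P.elem F (b, a)⁆) =
      (P.rhoQ F * m.map (algebraMap F (P.VLow F)) -
        m.map (algebraMap F (P.VLow F)) * P.rhoQ F) a b := by
  rw [rho_q, Ring.lie_def, Fintype.sum_prod_type]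
  simp only [Matrix.sub_apply, sub_smul, Finset.sum_sub_distrib, elem, Matrix.mul_apply,
    Matrix.map_apply, rhoQ, Matrix.of_apply, Matrix.single_apply]
  congr 1
  · refine Finset.sum_congr rfl fun c _ => ?_
    rw [Finset.sum_eq_single a]
    · rw [Finset.sum_eq_single b (fun d _ hd => by simp [hd.symm]) (by simp)]
      simp [MvPolynomial.smul_eq_C_mul, MvPolynomial.algebraMap_eq, mul_comm]
    · intro d _ hd
      simp [hd.symm]
    · simp
  · rw [Finset.sum_eq_single b]
    · refine Finset.sum_congr rfl fun c _ => ?_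
      rw [Finset.sum_eq_single a (fun d _ hd => by simp [hd.symm]) (by simp)]
      simp [MvPolynomial.smul_eq_C_mul, MvPolynomial.algebraMap_eq]
    · intro d _ hd
      simp [hd.symm]
    · simp

/-- The `λ`-bracket of a linear differential polynomial of order zero with a generator. -/
theorem lambdaBracketGen_q (G : P.Box × P.Box → P.Box × P.Box → Polynomial (P.VG F))
    (m : P.Gl F) (u : P.Box × P.Box) :
    lambdaBracketGen G (q m) u =
      ∑ v : P.Box × P.Box, Polynomial.C (MvPolynomial.C (m v.1 v.2)) * G v u := by
  have hp : ∀ v : (P.Box × P.Box) × ℕ, MvPolynomial.pderiv v (q m) =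
      if v.2 = 0 then MvPolynomial.C (m v.1.1 v.1.2) else 0 := by
    rintro ⟨v, n⟩
    rw [q, map_sum]
    simp only [Derivation.map_smul, MvPolynomial.pderiv_X]
    rw [Finset.sum_eq_single v]
    · by_cases hn : n = 0
      · subst hn
        simp [MvPolynomial.smul_eq_C_mul]
      · simp [hn, Ne.symm hn]
    · intro w _ hw
      simp [hw]
    · simp
  have hterm : ∀ v : P.Box × P.Box, ((G v u).sum fun k c => Polynomial.C c * (lamDel ^ k)
      (((-lamDel) ^ 0) (Polynomial.C (MvPolynomial.pderiv (v, 0) (q m))))) =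
      Polynomial.C (MvPolynomial.C (m v.1 v.2)) * G v u := by
    intro v
    rw [hp, if_pos rfl, pow_zero, Module.End.one_apply]
    simp only [lamDel_pow_C (DiffPoly.deriv_C (ι := P.Box × P.Box) (m v.1 v.2))]
    conv_rhs => rw [← Polynomial.sum_C_mul_X_pow_eq (G v u), Polynomial.sum, Finset.mul_sum]
    exact Finset.sum_congr rfl fun k _ => by ring
  have hzero : ∀ v : (P.Box × P.Box) × ℕ, MvPolynomial.pderiv v (q m) = 0 →
      ((G v.1 u).sum fun k c => Polynomial.C c * (lamDel ^ k)
        (((-lamDel) ^ v.2) (Polynomial.C (MvPolynomial.pderiv v (q m))))) = 0 := by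
    intro v hv
    simp [hv, Polynomial.sum]
  let e : P.Box × P.Box ↪ (P.Box × P.Box) × ℕ :=
    ⟨fun v => (v, 0), fun v w h => (Prod.ext_iff.mp h).1⟩
  rw [lambdaBracketGen, ← Finset.sum_congr rfl fun v _ => hterm v]
  refine Eq.trans ?_ (Finset.sum_map Finset.univ e
    (fun v : (P.Box × P.Box) × ℕ => (G v.1 u).sum fun k c => Polynomial.C c * (lamDel ^ k)
      (((-lamDel) ^ v.2) (Polynomial.C (MvPolynomial.pderiv v (q m))))))
  classical
  rw [Finset.sum_subset (Finset.subset_union_left (s₂ := Finset.univ.map e)) fun v _ hv =>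
    hzero v (MvPolynomial.pderiv_eq_zero_of_notMem_vars hv)]
  refine (Finset.sum_subset Finset.subset_union_right fun v _ hv => hzero v ?_).symm
  rw [hp, if_neg]
  intro h0
  exact hv (Finset.mem_map.mpr ⟨v.1, Finset.mem_univ _, Prod.ext rfl h0.symm⟩)

/-- The affine `λ`-bracket of an element of `𝔤` with a basis element. -/
theorem lambdaBracketGen_affineGen (ε : F) (S m : P.Gl F) (u : P.Box × P.Box) :
    lambdaBracketGen (affineGen ε S) (q m) u =
      Polynomial.C (q ⁅m, P.elem F u⁆) +
        Polynomial.C (MvPolynomial.C (Matrix.trace (m * P.elem F u))) * Polynomial.X +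
        Polynomial.C (MvPolynomial.C (ε * Matrix.trace (S * ⁅m, P.elem F u⁆))) := by
  have hadd : ∀ m m' : P.Gl F, ⁅m + m', P.elem F u⁆ = ⁅m, P.elem F u⁆ + ⁅m', P.elem F u⁆ := by
    intro m m'
    simp only [Ring.lie_def, add_mul, mul_add]
    abel
  have hsmul : ∀ (c : F) (m : P.Gl F), ⁅c • m, P.elem F u⁆ = c • ⁅m, P.elem F u⁆ := by
    intro c m
    simp only [Ring.lie_def, Matrix.smul_mul, Matrix.mul_smul, smul_sub]
  have hC : ∀ (c : F) (p : Polynomial (P.VG F)),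
      c • p = Polynomial.C (MvPolynomial.C c) * p := fun c p => by
    rw [← MvPolynomial.algebraMap_eq, ← Polynomial.algebraMap_eq,
      ← IsScalarTower.algebraMap_apply, ← Algebra.smul_def]
  let Φ : P.Gl F →ₗ[F] Polynomial (P.VG F) :=
    { toFun := fun m => Polynomial.C (q ⁅m, P.elem F u⁆) +
        Polynomial.C (MvPolynomial.C (Matrix.trace (m * P.elem F u))) * Polynomial.X +
        Polynomial.C (MvPolynomial.C (ε * Matrix.trace (S * ⁅m, P.elem F u⁆)))
      map_add' := fun m m' => by
        rw [hadd, q_add, add_mul, Matrix.mul_add, Matrix.trace_add, Matrix.trace_add, mul_add]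
        simp only [map_add]
        ring
      map_smul' := fun c m => by
        rw [hsmul, q_smul, Matrix.smul_mul, Matrix.mul_smul, Matrix.trace_smul,
          Matrix.trace_smul, RingHom.id_apply, hC]
        simp only [smul_eq_mul, MvPolynomial.smul_eq_C_mul, map_mul]
        ring }
  have hm : m = ∑ v : P.Box × P.Box, m v.1 v.2 • P.elem F v := by
    conv_lhs => rw [Matrix.matrix_eq_sum_single m]
    rw [Fintype.sum_prod_type]
    simp [elem, Matrix.smul_single]
  change _ = Φ m
  rw [lambdaBracketGen_q, show Φ m = ∑ v : P.Box × P.Box, m v.1 v.2 • Φ (P.elem F v) by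
    conv_lhs => rw [hm]
    rw [map_sum]
    simp only [map_smul]]
  refine Finset.sum_congr rfl fun v _ => ?_
  rw [← hC]
  rfl

/-- The map `w ↦ ρ{m_λ w}_ε`, for `m ∈ 𝔤`. -/
noncomputable def rhoBracket (ε : F) (S m : P.Gl F) : P.VLow F →+ Polynomial (P.VLow F) where
  toFun w := (affineBracket ε S (q m) (incl w)).map (rho : P.VG F →ₐ[F] P.VLow F).toRingHom
  map_zero' := by rw [map_zero, map_zero, Polynomial.map_zero]
  map_add' u v := by rw [map_add, map_add, Polynomial.map_add]

theorem rhoBracket_apply (ε : F) (S m : P.Gl F) (w : P.VLow F) : rhoBracket ε S m w =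
    (affineBracket ε S (q m) (incl w)).map (rho : P.VG F →ₐ[F] P.VLow F).toRingHom := rfl

theorem mem_W_iff {ε : F} {S : P.Gl F} {w : P.VLow F} :
    w ∈ W ε S ↔ ∀ m ∈ P.gGeHalf F, rhoBracket ε S m w = 0 := Iff.rfl

theorem rhoBracket_mul (ε : F) (S m : P.Gl F) (u v : P.VLow F) :
    rhoBracket ε S m (u * v) =
      Polynomial.C u * rhoBracket ε S m v + Polynomial.C v * rhoBracket ε S m u := by
  rw [rhoBracket_apply, map_mul, Derivation.leibniz, Polynomial.map_add,
    Polynomial.smul_eq_C_mul, Polynomial.smul_eq_C_mul, Polynomial.map_mul, Polynomial.map_mul,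
    Polynomial.map_C, Polynomial.map_C]
  have h : ∀ u : P.VLow F, (rho : P.VG F →ₐ[F] P.VLow F).toRingHom (incl u) = u := rho_incl
  rw [h, h]
  rfl

theorem rhoBracket_deriv (ε : F) (S m : P.Gl F) (v : P.VLow F) :
    rhoBracket ε S m v′ = lamDel (rhoBracket ε S m v) := by
  rw [rhoBracket_apply, rhoBracket_apply, incl_deriv, affineBracket, DiffPoly.lambdaBracket_deriv,
    map_lamDel _ rho_deriv]

/-- The algebra `𝒲` is closed under the derivation. -/
theorem deriv_mem_W {ε : F} {S : P.Gl F} {w : P.VLow F} (hw : w ∈ W ε S) : w′ ∈ W ε S :=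
  mem_W_iff.mpr fun m hm => by rw [rhoBracket_deriv, mem_W_iff.mp hw m hm, map_zero]

theorem rhoQ_apply (a b : P.Box) : P.rhoQ F a b = rhoGen (b, a) := rfl

theorem rhoQ_of_lt {a b : P.Box} (h : 1 < wt b - wt a) :
    P.rhoQ F a b = algebraMap F (P.VLow F) (P.nil F a b) :=
  rhoGen_of_lt h

/-- The elements `m ∈ 𝔤_{≥1/2}` act on `ρ(Q)` by infinitesimal gauge transformations:
`ρ{m_λ ρ(Q)} = [ρ(Q), m] + λ m`. -/
theorem rhoBracket_rhoQ [CharZero F] (ε : F) {S m : P.Gl F} (hS : S ∈ P.gPart F P.depth)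
    (hm : m ∈ P.gGeHalf F) (a b : P.Box) :
    rhoBracket ε S m (P.rhoQ F a b) =
      Polynomial.C ((P.rhoQ F * m.map (algebraMap F (P.VLow F)) -
        m.map (algebraMap F (P.VLow F)) * P.rhoQ F) a b) +
      Polynomial.C (algebraMap F (P.VLow F) (m a b)) * Polynomial.X := by
  by_cases h : xCoord b - xCoord a ≤ 1 / 2
  · rw [rhoQ_apply, rhoGen_of_le (u := (b, a)) h, rhoBracket_apply, incl_X, affineBracket,
      DiffPoly.lambdaBracket_X, pow_zero, Module.End.one_apply, lambdaBracketGen_affineGen,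
      ← rho_q_lie]
    have h1 : Matrix.trace (S * ⁅m, P.elem F (b, a)⁆) = 0 := by
      obtain ⟨e1, e2⟩ := mul_eq_zero_of_depth hS hm
      rw [Ring.lie_def, Matrix.mul_sub, ← Matrix.mul_assoc, e1, Matrix.zero_mul, Matrix.trace_sub,
        Matrix.trace_mul_comm S, Matrix.mul_assoc, e2]
      simp
    have h2 : Matrix.trace (m * P.elem F (b, a)) = m a b := by
      rw [elem, Matrix.trace_mul_single, MulOpposite.op_one, one_smul]
    have h3 : ∀ c : F, (rho : P.VG F →ₐ[F] P.VLow F).toRingHom (MvPolynomial.C c) =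
        algebraMap F (P.VLow F) c := fun c => rho.commutes c
    have h4 : ∀ v : P.VG F, (rho : P.VG F →ₐ[F] P.VLow F).toRingHom v = rho v := fun _ => rfl
    rw [h1, h2, mul_zero, map_zero, map_zero, add_zero, Polynomial.map_add, Polynomial.map_mul,
      Polynomial.map_C, Polynomial.map_C, Polynomial.map_X, h3, h4]
  · -- here `ρ(Q)_{ab}` is a constant, and all terms on the right-hand side vanish by degree
    rw [xCoord_sub_le_half_iff, not_le] at h
    have h1 : m a b = 0 := by
      by_contra hc
      have := wt_of_mem_gGeHalf hm hc
      lia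
    have h2 : ∀ c, m c b ≠ 0 → P.rhoQ F a c = 0 := by
      intro c hc
      have h3 := wt_of_mem_gGeHalf hm hc
      rw [rhoQ_of_lt (by lia)]
      by_contra h4
      have := wt_of_nil_ne_zero fun h5 => h4 (by rw [h5, map_zero])
      lia
    have h3 : ∀ c, m a c ≠ 0 → P.rhoQ F c b = 0 := by
      intro c hc
      have h3 := wt_of_mem_gGeHalf hm hc
      rw [rhoQ_of_lt (by lia)]
      by_contra h4
      have := wt_of_nil_ne_zero fun h5 => h4 (by rw [h5, map_zero])
      lia
    rw [rhoQ_of_lt h, rhoBracket_apply, AlgHom.commutes, Derivation.map_algebraMap,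
      Polynomial.map_zero, h1, map_zero, map_zero, zero_mul, add_zero, Matrix.sub_apply,
      Matrix.mul_apply, Matrix.mul_apply, Finset.sum_eq_zero, Finset.sum_eq_zero, sub_zero,
      map_zero]
    · intro c _
      by_cases hc : m a c = 0
      · simp [hc]
      · rw [h3 c hc, mul_zero]
    · intro c _
      by_cases hc : m c b = 0
      · simp [hc]
      · rw [h2 c hc, zero_mul]

end Pyramid

/-! ### Invertibility of `∂ + ρ(Q)` -/

namespace PsiDO

variable {V : Type*} [CommRing V] {n : Type*}

theorem hasLevel_of_orderLE {k : ℤ} {M : Matrix n n (PsiDO V)} (h : ∀ a b, OrderLE k (M a b)) :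
    HasLevel (fun _ => 0) (2 * k) M :=
  fun a b m hm => h a b m (by lia)

theorem del_eq : (del : PsiDO V) = monomial 1 1 := rfl

variable [Differential V]

theorem OrderLE.neg_one_pow_mul {k : ℤ} {a : PsiDO V} (ha : OrderLE k a) (j : ℕ) :
    OrderLE k ((-1) ^ j * a) := by
  rcases neg_one_pow_eq_or (PsiDO V) j with h | h
  · rwa [h, one_mul]
  · intro m hm
    rw [h, neg_one_mul, coeff_neg, ha m hm, neg_zero]

theorem isUnit_neg_one_pow_mul_monomial (j : ℕ) (k : ℤ) :
    IsUnit ((-1) ^ j * monomial k 1 : PsiDO V) :=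
  (isUnit_one.neg.pow j).mul (isUnit_monomial_one k)

variable [Fintype n] [DecidableEq n]

theorem isUnit_diagonal {a : PsiDO V} (ha : IsUnit a) :
    IsUnit (Matrix.diagonal fun _ : n => a) := by
  have := ha.map (Matrix.scalar n)
  exact this

/-- `∂ + A` is invertible for every matrix `A` of functions. -/
theorem isUnit_diagonal_del_add (A : Matrix n n V) :
    IsUnit (Matrix.diagonal (fun _ : n => (del : PsiDO V)) + (constHom V).mapMatrix A) := by
  have h1 : Matrix.diagonal (fun _ : n => (del : PsiDO V)) *
      Matrix.diagonal (fun _ : n => (monomial (-1) 1 : PsiDO V)) = 1 := by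
    rw [Matrix.diagonal_mul_diagonal, del_eq, monomial_mul_monomial_one, add_neg_cancel,
      monomial_zero_one, Matrix.diagonal_one]
  have h : Matrix.diagonal (fun _ : n => (del : PsiDO V)) + (constHom V).mapMatrix A =
      Matrix.diagonal (fun _ : n => (del : PsiDO V)) *
        (1 - -(Matrix.diagonal (fun _ : n => (monomial (-1) 1 : PsiDO V)) *
          (constHom V).mapMatrix A)) := by
    rw [sub_neg_eq_add, mul_add, mul_one, ← mul_assoc, h1, one_mul]
  rw [h]
  refine (isUnit_diagonal (isUnit_monomial_one 1)).mul
    (isUnit_one_sub (k := 2 * -1) (by lia) (HasLevel.neg (hasLevel_of_orderLE fun a b => ?_)))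
  rw [Matrix.diagonal_mul]
  exact (orderLE_monomial (-1) (1 : V)).mul (orderLE_monomial 0 (A a b))

end PsiDO

namespace Pyramid

variable {F : Type*} [Field F] {P : Pyramid}

open PsiDO

theorem rhoA_eq : P.rhoA F = Matrix.diagonal (fun _ => del) +
    (constHom (P.VLow F)).mapMatrix (P.rhoQ F) := by
  rw [rhoA]
  congr 1
  ext1 a b
  rw [Matrix.of_apply, rho_q_elem]
  rfl

theorem isUnit_rhoA : IsUnit (P.rhoA F) := by
  rw [rhoA_eq]
  exact isUnit_diagonal_del_add _

theorem J1_mul_mul_I1 {V : Type*} [CommRing V] [Differential V] [Algebra F V]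
    (B : Matrix P.Box P.Box (PsiDO V)) :
    constMat V (P.J1 F) * B * constMat V (P.I1 F) = B.submatrix P.lastBox P.firstBox := by
  ext1 i j
  rw [Matrix.mul_apply, Finset.sum_eq_single (P.firstBox j)]
  · rw [Matrix.mul_apply, Finset.sum_eq_single (P.lastBox i)]
    · simp only [constMat, Matrix.map_apply, J1, I1, Matrix.of_apply, if_true, map_one,
        Matrix.submatrix_apply]
      rw [← constHom_apply, map_one, one_mul, mul_one]
    · intro a _ ha
      simp only [constMat, Matrix.map_apply, J1, Matrix.of_apply, if_neg ha, map_zero]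
      rw [← constHom_apply, map_zero, zero_mul]
    · simp
  · intro a _ ha
    simp only [constMat, Matrix.map_apply, I1, Matrix.of_apply, if_neg ha, map_zero]
    rw [← constHom_apply, map_zero, mul_zero]
  · simp

/-! ### Gauge invariance -/

section Gauge

variable (ε : F) (S m : P.Gl F)

/-- The gauge transformation `v ↦ v + ρ{m_λ v} δ`. -/
noncomputable def gauge : P.VLow F →+* GaugeRing (P.VLow F) :=
  gaugeHom (rhoBracket ε S m) (rhoBracket_mul ε S m)

theorem gauge_deriv (v : P.VLow F) : gauge ε S m v′ = (gauge ε S m v)′ :=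
  gaugeHom_deriv _ _ (rhoBracket_deriv ε S m) v

/-- The gauge transformation applied to the coefficients of pseudodifferential operators. -/
noncomputable def gaugePsi : PsiDO (P.VLow F) →+* PsiDO (GaugeRing (P.VLow F)) :=
  mapHom (gauge ε S m) (gauge_deriv ε S m)

variable (F P) in
/-- The inclusion `V((∂⁻¹)) ⊆ (V[λ] ⊕ V[λ] δ)((∂⁻¹))` for `V = 𝒱(𝔤_{≤1/2})`. -/
noncomputable def inclPsi : PsiDO (P.VLow F) →+* PsiDO (GaugeRing (P.VLow F)) :=
  mapHom (gaugeIncl _) gaugeIncl_deriv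

/-- The matrix `m δ`. -/
noncomputable def gaugeMat (m : P.Gl F) : Matrix P.Box P.Box (GaugeRing (P.VLow F)) :=
  m.map fun c => TrivSqZeroExt.inr (Polynomial.C (algebraMap F (P.VLow F) c))

variable {S m}

/-- A gauge transformation acts on `∂ + ρ(Q)` by conjugation with `1 + m δ`. -/
theorem gaugePsi_rhoA [CharZero F] (hS : S ∈ P.gPart F P.depth) (hm : m ∈ P.gGeHalf F) :
    (1 + (constHom _).mapMatrix (gaugeMat m)) * (gaugePsi ε S m).mapMatrix (P.rhoA F) =
      (inclPsi F P).mapMatrix (P.rhoA F) * (1 + (constHom _).mapMatrix (gaugeMat m)) := by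
  let Δ : Matrix P.Box P.Box (PsiDO (GaugeRing (P.VLow F))) := Matrix.diagonal fun _ => del
  let Q : Matrix P.Box P.Box (GaugeRing (P.VLow F)) := (gaugeIncl (P.VLow F)).mapMatrix (P.rhoQ F)
  let D : Matrix P.Box P.Box (GaugeRing (P.VLow F)) :=
    (P.rhoQ F).map fun v => TrivSqZeroExt.inr (rhoBracket ε S m v)
  let Y : Matrix P.Box P.Box (GaugeRing (P.VLow F)) := gaugeMat m
  have h1 : (gaugePsi ε S m).mapMatrix (P.rhoA F) = Δ + (constHom _).mapMatrix (Q + D) := by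
    rw [rhoA_eq, map_add]
    congr 1
    · ext1 a b
      simp only [RingHom.mapMatrix_apply, Matrix.map_apply, Matrix.diagonal_apply, Δ]
      split_ifs
      · exact map_del _
      · exact map_zero _
    · ext1 a b
      exact map_const _ _
  have h2 : (inclPsi F P).mapMatrix (P.rhoA F) = Δ + (constHom _).mapMatrix Q := by
    rw [rhoA_eq, map_add]
    congr 1
    · ext1 a b
      simp only [RingHom.mapMatrix_apply, Matrix.map_apply, Matrix.diagonal_apply, Δ]
      split_ifs
      · exact map_del _
      · exact map_zero _
    · ext1 a b
      exact map_const _ _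
  have h3 : Δ * (constHom _).mapMatrix Y =
      (constHom _).mapMatrix Y * Δ + (constHom _).mapMatrix (Y.map fun y => y′) := by
    ext1 a b
    rw [Matrix.diagonal_mul, Matrix.add_apply, Matrix.mul_diagonal]
    exact del_mul_const (Y a b)
  have h4 : D + Y * Q + Y * D = (Y.map fun y => y′) + Q * Y := by
    ext1 a b
    have hb := rhoBracket_rhoQ ε hS hm a b
    have hd : (algebraMap F (P.VLow F) (m a b))′ = 0 := deriv_algebraMap_vLow _
    simp only [Matrix.add_apply, Matrix.mul_apply, Matrix.map_apply, Matrix.sub_apply,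
      RingHom.mapMatrix_apply, D, Y, Q, gaugeMat, gaugeIncl_apply] at hb ⊢
    rw [hb, GaugeRing.deriv_eq]
    ext1
    · simp [TrivSqZeroExt.fst_sum]
    · simp only [TrivSqZeroExt.snd_add, TrivSqZeroExt.snd_inr, TrivSqZeroExt.snd_sum,
        TrivSqZeroExt.snd_mul, TrivSqZeroExt.fst_inr, TrivSqZeroExt.fst_inl,
        TrivSqZeroExt.snd_inl, lamDel_apply, Differential.mapCoeffs_C, hd, smul_eq_mul, map_zero,
        zero_smul, MulOpposite.op_zero, add_zero, zero_add, Finset.sum_const_zero, map_sub,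
        map_sum, map_mul, MulOpposite.smul_eq_mul_unop, MulOpposite.unop_op, smul_zero,
        mul_zero, zero_mul]
      ring
  rw [h1, h2]
  change (1 + (constHom _).mapMatrix Y) * _ = _ * (1 + (constHom _).mapMatrix Y)
  have h5 : (constHom _).mapMatrix D + (constHom _).mapMatrix Y * (constHom _).mapMatrix Q +
      (constHom _).mapMatrix Y * (constHom _).mapMatrix D =
      (constHom _).mapMatrix (Y.map fun y => y′) +
        (constHom _).mapMatrix Q * (constHom _).mapMatrix Y := by
    rw [← map_mul, ← map_mul, ← map_mul, ← map_add, ← map_add, ← map_add, h4]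
  rw [map_add, ← sub_eq_zero]
  have h6 := sub_eq_zero.mpr h5
  rw [← h6, mul_add (Δ + _), mul_one, add_mul Δ, h3]
  noncomm_ring

theorem gaugeMat_apply_firstBox [CharZero F] (hm : m ∈ P.gGeHalf F) (a : P.Box) (j : P.TopRow) :
    gaugeMat m a (P.firstBox j) = 0 := by
  have h : m a (P.firstBox j) = 0 := by
    by_contra hc
    have h1 := wt_of_mem_gGeHalf hm hc
    have h2 := wt_le a
    rw [wt_firstBox] at h1
    lia
  simp [gaugeMat, h]

theorem gaugeMat_lastBox_apply [CharZero F] (hm : m ∈ P.gGeHalf F) (i : P.TopRow) (a : P.Box) :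
    gaugeMat m (P.lastBox i) a = 0 := by
  have h : m (P.lastBox i) a = 0 := by
    by_contra hc
    have h1 := wt_of_mem_gGeHalf hm hc
    have h2 := le_wt a
    rw [wt_lastBox] at h1
    lia
  simp [gaugeMat, h]

/-- The coefficients of an operator lie in `𝒲` if and only if it is invariant under all gauge
transformations. -/
theorem coeff_mem_W_iff {a : PsiDO (P.VLow F)} : (∀ n, a.coeff n ∈ W ε S) ↔
    ∀ m ∈ P.gGeHalf F, gaugePsi ε S m a = inclPsi F P a := by
  simp only [mem_W_iff]
  constructor
  · intro h m hm
    ext1 n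
    exact (gaugeHom_eq_gaugeIncl_iff _ _ _).mpr (h n m hm)
  · intro h n m hm
    exact (gaugeHom_eq_gaugeIncl_iff _ (rhoBracket_mul ε S m) _).mp
      (congrArg (fun b => b.coeff n) (h m hm))

/-- The inverse `L₁(∂)⁻¹ = J₁ (∂ + ρ(Q))⁻¹ I₁` is gauge invariant, since `J₁ m = 0 = m I₁` for
`m ∈ 𝔤_{≥1/2}`. -/
theorem gaugePsi_inverse_rhoA [CharZero F] (hS : S ∈ P.gPart F P.depth) (hm : m ∈ P.gGeHalf F)
    (i j : P.TopRow) :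
    gaugePsi ε S m (Ring.inverse (P.rhoA F) (P.lastBox i) (P.firstBox j)) =
      inclPsi F P (Ring.inverse (P.rhoA F) (P.lastBox i) (P.firstBox j)) := by
  set B := Ring.inverse (P.rhoA F)
  have hAB : P.rhoA F * B = 1 := Ring.mul_inverse_cancel _ isUnit_rhoA
  have hBA : B * P.rhoA F = 1 := Ring.inverse_mul_cancel _ isUnit_rhoA
  set g := 1 + (constHom _).mapMatrix (gaugeMat m)
  have h : (inclPsi F P).mapMatrix B * g = g * (gaugePsi ε S m).mapMatrix B := by
    calc (inclPsi F P).mapMatrix B * g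
        = (inclPsi F P).mapMatrix B * (g * (gaugePsi ε S m).mapMatrix (P.rhoA F)) *
            (gaugePsi ε S m).mapMatrix B := by
          rw [mul_assoc, mul_assoc g, ← map_mul, hAB, map_one, mul_one]
      _ = g * (gaugePsi ε S m).mapMatrix B := by
          rw [gaugePsi_rhoA ε hS hm, ← mul_assoc, ← map_mul, hBA, map_one, one_mul]
  have h1 := congrFun (congrFun h (P.lastBox i)) (P.firstBox j)
  rw [mul_add, add_mul, mul_one, one_mul, Matrix.add_apply, Matrix.add_apply, Matrix.mul_apply,
    Matrix.mul_apply, Finset.sum_eq_zero, Finset.sum_eq_zero, add_zero, add_zero] at h1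
  · exact h1.symm
  · intro a _
    have : (constHom _).mapMatrix (gaugeMat m) (P.lastBox i) a = 0 := by
      rw [RingHom.mapMatrix_apply, Matrix.map_apply, gaugeMat_lastBox_apply hm, map_zero]
    rw [this, zero_mul]
  · intro a _
    have : (constHom _).mapMatrix (gaugeMat m) a (P.firstBox j) = 0 := by
      rw [RingHom.mapMatrix_apply, Matrix.map_apply, gaugeMat_apply_firstBox hm, map_zero]
    rw [this, mul_zero]

end Gauge

/-! ### Existence of `L₁(∂)` -/

variable (F P) in
/-- The inverse of `∂ + f`. -/
noncomputable def delNilInv : Matrix P.Box P.Box (PsiDO (P.VLow F)) := Matrix.of fun a b =>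
  if a.1 = b.1 ∧ (b.2 : ℕ) ≤ a.2 then
    (-1) ^ ((a.2 : ℕ) - b.2) * monomial (-1 - ((a.2 : ℕ) - b.2 : ℕ)) 1 else 0

theorem del_nil_mul_delNilInv : (Matrix.diagonal (fun _ => del) +
    (constHom (P.VLow F)).mapMatrix ((P.nil F).map (algebraMap F (P.VLow F)))) *
      P.delNilInv F = 1 := by
  have hcomm : ∀ (k : ℕ) (l : ℤ), (del : PsiDO (P.VLow F)) * ((-1) ^ k * monomial l 1) =
      (-1) ^ k * monomial (1 + l) 1 := by
    intro k l
    rw [← mul_assoc, ((Commute.neg_one_right del).pow_right k).eq, mul_assoc, del_eq,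
      monomial_mul_monomial_one]
  ext1 a b
  obtain ⟨i, h⟩ := a
  obtain ⟨j, l⟩ := b
  rw [add_mul, Matrix.add_apply, Matrix.diagonal_mul, Matrix.mul_apply]
  rcases Nat.eq_zero_or_pos (h : ℕ) with h0 | h0
  · rw [Finset.sum_eq_zero, add_zero]
    · by_cases hij : i = j
      · subst hij
        by_cases hl : h = l
        · subst hl
          simp [delNilInv, monomial_zero_one, del_eq, monomial_mul_monomial_one]
        · have : ¬ (l : ℕ) ≤ h := fun hc => hl (Fin.ext (by lia))
          rw [Matrix.one_apply_ne (by simpa using hl)]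
          simp only [delNilInv, Matrix.of_apply, this, and_false, if_false, mul_zero]
      · rw [Matrix.one_apply_ne (fun hc => hij (congrArg Sigma.fst hc))]
        simp only [delNilInv, Matrix.of_apply, hij, false_and, if_false, mul_zero]
    · intro c _
      have : P.nil F ⟨i, h⟩ c = 0 := by
        simp only [nil, Matrix.of_apply, ite_eq_right_iff]
        intro hc
        lia
      rw [RingHom.mapMatrix_apply, Matrix.map_apply, Matrix.map_apply, this, map_zero, map_zero,
        zero_mul]
  · rw [Finset.sum_eq_single (⟨i, ⟨h - 1, by have := h.isLt; lia⟩⟩ : P.Box)]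
    · have : P.nil F ⟨i, h⟩ ⟨i, ⟨h - 1, by have := h.isLt; lia⟩⟩ = 1 := by
        simp only [nil, Matrix.of_apply, ite_eq_left_iff]
        intro hc
        exact absurd ⟨trivial, by lia⟩ hc
      rw [RingHom.mapMatrix_apply, Matrix.map_apply, Matrix.map_apply, this, map_one, map_one,
        one_mul]
      by_cases hij : i = j
      · subst hij
        simp only [delNilInv, Matrix.of_apply, true_and]
        by_cases hl : h = l
        · subst hl
          rw [if_pos le_rfl, if_neg (by lia), Matrix.one_apply_eq, hcomm]
          simp [monomial_zero_one]
        · rw [Matrix.one_apply_ne (by simpa using hl)]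
          have hl' : (h : ℕ) ≠ l := fun hc => hl (Fin.ext hc)
          by_cases hlt : (l : ℕ) ≤ h
          · obtain ⟨k, hk⟩ : ∃ k : ℕ, (h : ℕ) = l + (k + 1) := ⟨h - l - 1, by lia⟩
            rw [if_pos hlt, if_pos (by lia), hcomm, show (h : ℕ) - l = k + 1 by lia,
              show (h : ℕ) - 1 - l = k by lia, pow_succ]
            push_cast
            rw [show (1 + (-1 - ((k : ℤ) + 1))) = -1 - k by ring]
            noncomm_ring
          · rw [if_neg hlt, if_neg (by lia), mul_zero, add_zero]
      · rw [Matrix.one_apply_ne (fun hc => hij (congrArg Sigma.fst hc))]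
        simp only [delNilInv, Matrix.of_apply, hij, false_and, if_false, mul_zero, add_zero]
    · rintro ⟨c, k⟩ _ hc
      have : P.nil F ⟨i, h⟩ ⟨c, k⟩ = 0 := by
        simp only [nil, Matrix.of_apply, ite_eq_right_iff]
        rintro ⟨rfl, h2⟩
        exact absurd (congrArg (Sigma.mk i) (Fin.ext (by simp only; lia))) hc
      rw [RingHom.mapMatrix_apply, Matrix.map_apply, Matrix.map_apply, this, map_zero, map_zero,
        zero_mul]
    · simp

theorem hasLevel_delNilInv : HasLevel wt (-2) (P.delNilInv F) := by
  intro a b m hm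
  rw [delNilInv, Matrix.of_apply]
  split_ifs with h
  · obtain ⟨i, k⟩ := a
    obtain ⟨j, l⟩ := b
    obtain ⟨h1, h2⟩ := h
    simp only at h1 h2
    subst h1
    refine (orderLE_monomial _ _).neg_one_pow_mul _ m ?_
    simp only [wt] at hm ⊢
    lia
  · rfl

/-- The leading term of `L₁(∂)⁻¹` is `(-1)^{p₁-1} ∂^{-p₁}`. -/
theorem exists_inverse_rhoA_eq (i j : P.TopRow) : ∃ R, OrderLE (-(P.p 0 : ℤ) - 1) R ∧
    Ring.inverse (P.rhoA F) (P.lastBox i) (P.firstBox j) =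
      (if i = j then (-1) ^ (P.p 0 - 1) * monomial (-(P.p 0 : ℤ)) 1 else 0) + R := by
  let Y : Matrix P.Box P.Box (P.VLow F) := P.rhoQ F - (P.nil F).map (algebraMap F (P.VLow F))
  let T : Matrix P.Box P.Box (PsiDO (P.VLow F)) := -((constHom _).mapMatrix Y * P.delNilInv F)
  have hY : HasLevel wt 1 ((constHom _).mapMatrix Y) := by
    intro a b m hm
    change (const (Y a b)).coeff m = 0
    by_cases h : 1 < wt b - wt a
    · have : Y a b = 0 := by
        change P.rhoQ F a b - algebraMap F (P.VLow F) (P.nil F a b) = 0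
        rw [rhoQ_of_lt h, sub_self]
      rw [coeff_const, this, ite_self]
    · rw [coeff_const, if_neg (by lia)]
  have hT : HasLevel wt (-1) T := (hY.mul hasLevel_delNilInv).neg
  have hA : P.rhoA F * P.delNilInv F = 1 - T := by
    have : P.rhoA F = (Matrix.diagonal (fun _ => del) +
      (constHom (P.VLow F)).mapMatrix ((P.nil F).map (algebraMap F (P.VLow F)))) +
        (constHom _).mapMatrix Y := by
      rw [rhoA_eq, map_sub]
      abel
    rw [this, add_mul, del_nil_mul_delNilInv, sub_neg_eq_add]
  obtain ⟨G, hG, -, hG0⟩ := exists_inverse_one_sub (by lia) hT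
  have hinv : Ring.inverse (P.rhoA F) = P.delNilInv F * G := by
    refine left_inv_eq_right_inv (Ring.inverse_mul_cancel _ isUnit_rhoA) ?_
    rw [← mul_assoc, hA, hG]
  have hG1 : G = 1 + T * G := by
    rw [sub_mul, one_mul, sub_eq_iff_eq_add] at hG
    exact hG
  refine ⟨(P.delNilInv F * (T * G)) (P.lastBox i) (P.firstBox j), ?_, ?_⟩
  · intro m hm
    refine hasLevel_delNilInv.mul (hT.mul hG0) _ _ m ?_
    rw [wt_lastBox, wt_firstBox]
    lia
  · rw [hinv]
    conv_lhs => rw [hG1, mul_add, mul_one, Matrix.add_apply]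
    congr 1
    simp only [delNilInv, Matrix.of_apply, lastBox, firstBox, Nat.zero_le, and_true, Nat.sub_zero,
      i.2]
    by_cases hij : i = j
    · have h0 := P.p_pos 0
      rw [if_pos (congrArg Subtype.val hij), if_pos hij,
        show (-1 - ((P.p 0 - 1 : ℕ) : ℤ)) = -(P.p 0 : ℤ) by lia]
    · rw [if_neg (fun h => hij (Subtype.ext h)), if_neg hij]

theorem isUnit_submatrix_inverse_rhoA :
    IsUnit ((Ring.inverse (P.rhoA F)).submatrix P.lastBox P.firstBox) := by
  set B := (Ring.inverse (P.rhoA F)).submatrix P.lastBox P.firstBox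
  let u : PsiDO (P.VLow F) := (-1) ^ (P.p 0 - 1) * monomial (P.p 0) 1
  have hu : IsUnit (Matrix.diagonal fun _ : P.TopRow => u) :=
    isUnit_diagonal (isUnit_neg_one_pow_mul_monomial _ _)
  rw [← hu.mul_right_iff]
  have : B * Matrix.diagonal (fun _ => u) = 1 - (1 - B * Matrix.diagonal (fun _ => u)) := by abel
  rw [this]
  refine isUnit_one_sub (k := 2 * -1) (by lia) (hasLevel_of_orderLE fun i j => ?_)
  obtain ⟨R, hR, hB⟩ := exists_inverse_rhoA_eq (F := F) i j
  rw [Matrix.sub_apply, Matrix.mul_diagonal]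
  change OrderLE (-1) (_ - Ring.inverse (P.rhoA F) (P.lastBox i) (P.firstBox j) * u)
  rw [hB, add_mul]
  have h1 : OrderLE (-1) (-(R * u)) := by
    have := hR.mul ((orderLE_monomial (P.p 0 : ℤ) (1 : P.VLow F)).neg_one_pow_mul (P.p 0 - 1))
    intro m hm
    rw [coeff_neg, this m (by lia), neg_zero]
  have h2 : (-1) ^ (P.p 0 - 1) * monomial (-(P.p 0 : ℤ)) 1 * u = 1 := by
    have h3 : ((-1) ^ (P.p 0 - 1) : PsiDO (P.VLow F)) * (-1) ^ (P.p 0 - 1) = 1 := by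
      rw [← pow_add, Even.neg_one_pow ⟨_, rfl⟩]
    rw [mul_assoc, ← mul_assoc (monomial _ _),
      ((Commute.neg_one_right (monomial (-(P.p 0 : ℤ)) 1)).pow_right _).eq, mul_assoc, ← mul_assoc,
      h3, one_mul, monomial_mul_monomial_one, neg_add_cancel, monomial_zero_one]
  rw [Matrix.one_apply]
  split_ifs with hij
  · rwa [h2, ← sub_sub, sub_self, zero_sub]
  · rwa [zero_mul, zero_add, zero_sub]

theorem quasidetExists_rhoA : QuasidetExists (P.rhoA F) (constMat _ (P.I1 F))
    (constMat _ (P.J1 F)) := by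
  refine ⟨isUnit_rhoA, ?_⟩
  rw [J1_mul_mul_I1]
  exact isUnit_submatrix_inverse_rhoA

theorem inverse_L1 :
    Ring.inverse (P.L1 F) = (Ring.inverse (P.rhoA F)).submatrix P.lastBox P.firstBox := by
  rw [L1, quasidet, J1_mul_mul_I1]
  obtain ⟨u, hu⟩ := isUnit_submatrix_inverse_rhoA (F := F) (P := P)
  rw [← hu, Ring.inverse_unit, Ring.inverse_unit, inv_inv]

theorem isUnit_L1 : IsUnit (P.L1 F) := by
  rw [L1, quasidet, J1_mul_mul_I1]
  exact isUnit_submatrix_inverse_rhoA.ringInverse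

theorem coeff_inverse_L1_mem_W [CharZero F] (ε : F) {S : P.Gl F} (hS : S ∈ P.gPart F P.depth)
    (i j : P.TopRow) (n : ℤ) : (Ring.inverse (P.L1 F) i j).coeff n ∈ W ε S := by
  rw [inverse_L1]
  exact (coeff_mem_W_iff ε).mpr (fun m hm => gaugePsi_inverse_rhoA ε hS hm i j) n

theorem coeff_L1_mem_W [CharZero F] (ε : F) {S : P.Gl F} (hS : S ∈ P.gPart F P.depth)
    (i j : P.TopRow) (n : ℤ) : (P.L1 F i j).coeff n ∈ W ε S := by
  refine (coeff_mem_W_iff ε).mpr (fun m hm => ?_) n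
  have h1 : (gaugePsi ε S m).mapMatrix (Ring.inverse (P.L1 F)) =
      (inclPsi F P).mapMatrix (Ring.inverse (P.L1 F)) := by
    ext1 i j
    rw [inverse_L1]
    exact gaugePsi_inverse_rhoA ε hS hm i j
  have h2 : (gaugePsi ε S m).mapMatrix (P.L1 F) = (inclPsi F P).mapMatrix (P.L1 F) := by
    refine left_inv_eq_right_inv (a := (gaugePsi ε S m).mapMatrix (Ring.inverse (P.L1 F))) ?_ ?_
    · rw [← map_mul, Ring.mul_inverse_cancel _ isUnit_L1, map_one]
    · rw [h1, ← map_mul, Ring.inverse_mul_cancel _ isUnit_L1, map_one]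
  exact congrFun (congrFun h2 i) j

end Pyramid

/-! ### Linear algebra over the constants -/

section LinearAlgebra

variable {F : Type*} [Field F] {m s : Type*} [Fintype m] [DecidableEq m] [Fintype s]
  [DecidableEq s]

theorem IsCanonicalFactorization.exists_inverses {A : Matrix m m F} {I : Matrix m s F}
    {J : Matrix s m F} (h : IsCanonicalFactorization A I J) :
    (∃ L : Matrix s m F, L * I = 1) ∧ ∃ R : Matrix m s F, J * R = 1 := by
  obtain ⟨b, hI, hJ⟩ := h
  constructor
  · have hinj : LinearMap.ker I.mulVecLin = ⊥ := by
      rw [LinearMap.ker_eq_bot']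
      intro c hc
      have h1 : ∑ a, c a • b a = 0 := by
        apply Subtype.ext
        funext i
        have h2 := congrFun hc i
        rw [Matrix.mulVecLin_apply, Matrix.mulVec, dotProduct] at h2
        simp only [hI] at h2
        simpa [mul_comm] using h2
      exact funext fun a => Fintype.linearIndependent_iff.mp b.linearIndependent c h1 a
    obtain ⟨g, hg⟩ := LinearMap.exists_leftInverse_of_injective _ hinj
    refine ⟨LinearMap.toMatrix' g, ?_⟩
    have h2 := congrArg LinearMap.toMatrix' hg
    rwa [LinearMap.toMatrix'_comp, ← Matrix.toLin'_apply', LinearMap.toMatrix'_toLin',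
      LinearMap.toMatrix'_id] at h2
  · rw [← Matrix.mulVec_surjective_iff_exists_right_inverse]
    intro y
    obtain ⟨x, hx⟩ := A.mulVecLin.surjective_rangeRestrict
      (b.repr.symm (Finsupp.equivFunOnFinite.symm y))
    refine ⟨x, ?_⟩
    funext a
    have h1 : x = ∑ j, x j • (Pi.single j 1 : m → F) := by
      simpa [Pi.single_apply] using pi_eq_sum_univ' x
    have h2 : b.repr (A.mulVecLin.rangeRestrict x) a = y a := by rw [hx]; simp
    rw [← h2]
    conv_rhs => rw [h1, map_sum, map_sum, Finsupp.finsetSum_apply]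
    refine Finset.sum_congr rfl fun j _ => ?_
    change J a j * x j = _
    rw [hJ, map_smul, map_smul, Finsupp.smul_apply, smul_eq_mul, mul_comm]

/-- For injective `I` and surjective `J`, some invertible `Z` makes `J Z I` invertible. -/
theorem exists_isUnit_mul_mul [Infinite F] {I : Matrix m s F} {J : Matrix s m F}
    {L : Matrix s m F} {R : Matrix m s F} (hL : L * I = 1) (hR : J * R = 1) :
    ∃ Z : Matrix m m F, IsUnit Z ∧ IsUnit (J * Z * I) := by
  -- `Z = R L + c` works for all but finitely many scalars `c`
  let p : F[X] := (-(R * L)).charpoly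
  let r : F[X] := (1 + (Polynomial.X : F[X]) • (J * I).map Polynomial.C).det
  have hp : p ≠ 0 := (Matrix.charpoly_monic _).ne_zero
  have hr : r ≠ 0 := by
    intro h
    have h1 := eval_det_add_X_smul (1 : Matrix s s F[X]) (J * I)
    change r.eval 0 = _ at h1
    rw [h] at h1
    simp at h1
  obtain ⟨c, hc⟩ : ∃ c, (p * r).eval c ≠ 0 := by
    by_contra! h
    exact mul_ne_zero hp hr (Polynomial.funext fun c => by rw [h c, Polynomial.eval_zero])
  rw [Polynomial.eval_mul, mul_ne_zero_iff] at hc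
  refine ⟨Matrix.scalar m c + R * L, ?_, ?_⟩
  · rw [Matrix.isUnit_iff_isUnit_det, isUnit_iff_ne_zero]
    have h := hc.1
    rwa [Matrix.eval_charpoly, sub_neg_eq_add] at h
  · rw [Matrix.isUnit_iff_isUnit_det, isUnit_iff_ne_zero]
    have h := hc.2
    rw [← Polynomial.coe_evalRingHom, RingHom.map_det] at h
    convert h using 2
    have e : J * (Matrix.scalar m c + R * L) * I = 1 + c • (J * I) := by
      rw [Matrix.mul_add, Matrix.add_mul, ← Matrix.mul_assoc J R, hR, Matrix.one_mul, hL, add_comm,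
        Matrix.scalar_apply, ← Matrix.smul_one_eq_diagonal, Matrix.mul_smul, Matrix.mul_one,
        Matrix.smul_mul]
    rw [e]
    ext i j
    change _ = Polynomial.eval c (((1 : Matrix s s F[X]) i j) +
      Polynomial.X * Polynomial.C ((J * I) i j))
    rw [Matrix.add_apply, Matrix.smul_apply, Matrix.one_apply, Matrix.one_apply,
      Polynomial.eval_add, Polynomial.eval_mul, Polynomial.eval_X, Polynomial.eval_C, smul_eq_mul]
    split_ifs <;> simp

end LinearAlgebra

namespace PsiDO

/-! ### Operators with constant coefficients -/

section Const

variable {F : Type*} [Field F] [Differential F]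

theorem monomial_natCast {V : Type*} [CommRing V] [Differential V] (k : ℕ) :
    (monomial (k : ℤ) 1 : PsiDO V) = del ^ k := by
  induction k with
  | zero => rfl
  | succ k ih => rw [pow_succ, ← ih, del_eq, monomial_mul_monomial_one, Nat.cast_succ]

theorem commute_const_monomial {V : Type*} [CommRing V] [Differential V] {c : V} (hc : c′ = 0)
    (j k : ℕ) : Commute (const c) ((-1) ^ j * monomial (k : ℤ) 1 : PsiDO V) := by
  have h : Commute (const c) (del : PsiDO V) := by
    have := del_mul_const c
    rw [hc, ← constHom_apply, ← constHom_apply, map_zero, add_zero] at this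
    exact this.symm
  rw [monomial_natCast]
  exact ((Commute.neg_one_right _).pow_right j).mul_right (h.pow_right k)

/-- Substitution of `(-1)ʲ ∂ᵏ` into polynomials with constant coefficients. -/
noncomputable def evalMonomial (hF : ∀ c : F, c′ = 0) (j k : ℕ) : F[X] →+* PsiDO F :=
  Polynomial.eval₂RingHom' (constHom F) ((-1) ^ j * monomial (k : ℤ) 1)
    fun c => commute_const_monomial (hF c) j k

variable (hF : ∀ c : F, c′ = 0) (j : ℕ) {k : ℕ}

theorem evalMonomial_C (c : F) : evalMonomial hF j k (Polynomial.C c) = const c :=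
  Polynomial.eval₂_C _ _

theorem evalMonomial_X :
    evalMonomial hF j k Polynomial.X = (-1) ^ j * monomial (k : ℤ) 1 :=
  Polynomial.eval₂_X _ _

theorem evalMonomial_ne_zero (hk : 0 < k) {p : F[X]} (hp : p ≠ 0) :
    evalMonomial hF j k p ≠ 0 := by
  intro h
  have hpow : ∀ i : ℕ, (((-1) ^ j * monomial (k : ℤ) 1 : PsiDO F)) ^ i =
      (-1) ^ (j * i) * monomial ((k * i : ℕ) : ℤ) 1 := by
    intro i
    rw [monomial_natCast, monomial_natCast, pow_mul, pow_mul,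
      ((Commute.neg_one_left (del ^ k)).pow_left j).mul_pow]
  have h1 : (evalMonomial hF j k p).coeff ((k * p.natDegree : ℕ) : ℤ) =
      p.leadingCoeff * (-1) ^ (j * p.natDegree) := by
    have hs : ∀ i (m : ℤ), (((-1) ^ (j * i) * monomial ((k * i : ℕ) : ℤ) 1 : PsiDO F)).coeff m =
        if m = ((k * i : ℕ) : ℤ) then (-1) ^ (j * i) else 0 := by
      intro i m
      rcases neg_one_pow_eq_or ℤ (j * i) with e | e
      · have e1 : ∀ (R : Type _) [Ring R], (-1 : R) ^ (j * i) = 1 := fun R _ => by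
          have := congrArg (Int.cast (R := R)) e
          simpa using this
        rw [e1, e1, one_mul, coeff_monomial]
      · have e1 : ∀ (R : Type _) [Ring R], (-1 : R) ^ (j * i) = -1 := fun R _ => by
          have := congrArg (Int.cast (R := R)) e
          simpa using this
        rw [e1, e1, neg_one_mul, coeff_neg, coeff_monomial]
        split_ifs <;> simp
    change (Polynomial.eval₂ (constHom F) _ p).coeff _ = _
    rw [Polynomial.eval₂_eq_sum, Polynomial.sum, coeff_sum, Finset.sum_eq_single p.natDegree]
    · rw [constHom_apply, const_mul_coeff, hpow, hs, if_pos rfl]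
      rfl
    · intro i _ hi
      rw [constHom_apply, const_mul_coeff, hpow, hs, if_neg, mul_zero]
      intro hc
      exact hi (Nat.eq_of_mul_eq_mul_left hk (by exact_mod_cast hc.symm))
    · intro hn
      rw [Polynomial.notMem_support_iff.mp hn, map_zero, zero_mul, coeff_zero]
  rw [h, coeff_zero] at h1
  exact mul_ne_zero (Polynomial.leadingCoeff_ne_zero.mpr hp)
    (pow_ne_zero _ (neg_ne_zero.mpr one_ne_zero)) h1.symm

theorem isUnit_evalMonomial (hk : 0 < k) {p : F[X]} (hp : p ≠ 0) :
    IsUnit (evalMonomial hF j k p) :=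
  (isUnit_or_eq_zero _).resolve_right (evalMonomial_ne_zero hF j hk hp)

theorem isUnit_mapMatrix_evalMonomial (hk : 0 < k) {n : Type*} [Fintype n] [DecidableEq n]
    {N : Matrix n n F[X]} (hN : N.det ≠ 0) : IsUnit ((evalMonomial hF j k).mapMatrix N) := by
  set θ := evalMonomial hF j k
  have hunit : IsUnit (θ.mapMatrix (Matrix.scalar n N.det)) := by
    have : θ.mapMatrix (Matrix.scalar n N.det) = Matrix.scalar n (θ N.det) := by
      rw [Matrix.scalar_apply, Matrix.scalar_apply, RingHom.mapMatrix_apply,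
        Matrix.diagonal_map (map_zero θ)]
    rw [this]
    exact (isUnit_evalMonomial hF j hk hN).map _
  obtain ⟨⟨u, v, huv, hvu⟩, hu⟩ := hunit
  change u = _ at hu
  have h1 : θ.mapMatrix N * θ.mapMatrix N.adjugate = u := by
    rw [hu, ← map_mul, Matrix.mul_adjugate, Matrix.scalar_apply, ← Matrix.smul_one_eq_diagonal]
  have h2 : θ.mapMatrix N.adjugate * θ.mapMatrix N = u := by
    rw [hu, ← map_mul, Matrix.adjugate_mul, Matrix.scalar_apply, ← Matrix.smul_one_eq_diagonal]
  have h3 : v * θ.mapMatrix N.adjugate * θ.mapMatrix N = 1 := by rw [mul_assoc, h2, hvu]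
  have h4 : θ.mapMatrix N * (θ.mapMatrix N.adjugate * v) = 1 := by rw [← mul_assoc, h1, huv]
  exact ⟨⟨θ.mapMatrix N, θ.mapMatrix N.adjugate * v, h4,
    by rw [← left_inv_eq_right_inv h3 h4, h3]⟩, rfl⟩

end Const

end PsiDO

namespace Pyramid

open PsiDO

variable {F : Type*} [Field F] {P : Pyramid}

section ConstMat

variable {V : Type*} [CommRing V] [Differential V] [Algebra F V] {l m n : Type*}

theorem constMat_eq (M : Matrix m n F) :
    constMat V M = M.map ((constHom V).comp (algebraMap F V)) := rfl

theorem constMat_mul [Fintype m] (M : Matrix l m F) (N : Matrix m n F) :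
    constMat V (M * N) = constMat V M * constMat V N := by
  simp only [constMat_eq, Matrix.map_mul]

theorem constMat_add (M N : Matrix m n F) :
    constMat V (M + N) = constMat V M + constMat V N := by
  simp only [constMat_eq]
  exact Matrix.map_add _ (map_add _) _ _

theorem constMat_map {V' : Type*} [CommRing V'] [Differential V'] [Algebra F V']
    (φ : V →+* V') (hφ : ∀ v, φ v′ = (φ v)′)
    (hφF : ∀ c : F, φ (algebraMap F V c) = algebraMap F V' c) (M : Matrix m n F) :
    (constMat V M).map (mapHom φ hφ) = constMat V' M := by
  ext1 i j
  exact (map_const φ _).trans (congrArg const (hφF _))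

end ConstMat

/-! ### Specialization to constants -/

section Specialization

/-- The matrix `I₁ W J₁`, as a matrix indexed by the boxes. -/
def cornerMat (W : Matrix P.TopRow P.TopRow F) : P.Gl F := P.I1 F * W * P.J1 F

theorem wt_of_cornerMat_ne_zero {W : Matrix P.TopRow P.TopRow F} {a b : P.Box}
    (h : cornerMat W a b ≠ 0) : wt a = P.p 0 - 1 ∧ wt b = 1 - P.p 0 := by
  rw [cornerMat, Matrix.mul_apply] at h
  obtain ⟨j, -, hj⟩ := Finset.exists_ne_zero_of_sum_ne_zero h
  obtain ⟨h1, h2⟩ := mul_ne_zero_iff.mp hj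
  rw [Matrix.mul_apply] at h1
  obtain ⟨i, -, hi⟩ := Finset.exists_ne_zero_of_sum_ne_zero h1
  have h3 := (mul_ne_zero_iff.mp hi).1
  simp only [J1, I1, Matrix.of_apply, ne_eq, ite_eq_right_iff, one_ne_zero, imp_false,
    not_not] at h2 h3
  rw [h2, h3, wt_firstBox, wt_lastBox]
  exact ⟨rfl, rfl⟩

/-- The specialization of the differential variables to constants for which `ρ(Q)` becomes
`f + I₁ W J₁`. -/
noncomputable def spec (W : Matrix P.TopRow P.TopRow F) : P.VLow F →ₐ[F] F :=
  MvPolynomial.aeval fun v => if v.2 = 0 then cornerMat W v.1.1.2 v.1.1.1 else 0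

theorem spec_rhoQ (W : Matrix P.TopRow P.TopRow F) (a b : P.Box) :
    spec W (P.rhoQ F a b) = (P.nil F + cornerMat W) a b := by
  rw [Matrix.add_apply]
  by_cases h : wt b - wt a ≤ 1
  · have h1 : P.nil F a b = 0 := by
      by_contra hc
      have := wt_of_nil_ne_zero hc
      lia
    have h2 : xCoord b - xCoord a ≤ 1 / 2 := (xCoord_sub_le_half_iff b a).mpr h
    rw [rhoQ_apply, rhoGen_of_le (u := (b, a)) h2, spec, MvPolynomial.aeval_X, if_pos rfl, h1,
      zero_add]
  · have h1 : cornerMat W a b = 0 := by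
      by_contra hc
      obtain ⟨h1, h2⟩ := wt_of_cornerMat_ne_zero hc
      have := P.p_pos 0
      lia
    rw [rhoQ_of_lt (by lia), AlgHom.commutes, h1, add_zero]
    rfl

variable [Differential F] (hF : ∀ c : F, c′ = 0) (W : Matrix P.TopRow P.TopRow F)

include hF in
theorem spec_deriv (v : P.VLow F) : (spec W).toRingHom v′ = ((spec W).toRingHom v)′ := by
  have h : ∀ i n, spec W (MvPolynomial.X (i, n + 1)) = (spec W (MvPolynomial.X (i, n)))′ := by
    intro i n
    rw [hF, spec, MvPolynomial.aeval_X, if_neg (Nat.succ_ne_zero n)]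
  have := DiffPoly.map_deriv hF (spec W) h v
  exact this

/-- The specialization of pseudodifferential operators induced by `spec`. -/
noncomputable def specPsi : PsiDO (P.VLow F) →+* PsiDO F :=
  mapHom (spec W).toRingHom (spec_deriv hF W)

theorem specPsi_rhoA : (specPsi hF W).mapMatrix (P.rhoA F) =
    Matrix.diagonal (fun _ => del) + constMat F (P.nil F + cornerMat W) := by
  rw [rhoA_eq, map_add]
  congr 1
  · ext1 a b
    simp only [RingHom.mapMatrix_apply, Matrix.map_apply, Matrix.diagonal_apply]
    split_ifs
    · exact map_del _
    · exact map_zero _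
  · ext1 a b
    exact (map_const _ _).trans (congrArg const (spec_rhoQ W a b))

/-- The operator `-(-∂)^{p₁}`. -/
noncomputable abbrev topOp (F : Type*) [Field F] [Differential F] (P : Pyramid) : PsiDO F :=
  (-1) ^ (P.p 0 - 1) * monomial (P.p 0 : ℤ) 1

/-- The matrix whose `i`-th column solves `(∂ + f) v = -(-∂)^{p₁} e_{i1}`. -/
noncomputable def colMat (F : Type*) [Field F] [Differential F] (P : Pyramid) :
    Matrix P.Box P.TopRow (PsiDO F) :=
  Matrix.of fun a i => if a.1 = i.1 then
    (-1) ^ (P.p 0 - 1 - (a.2 : ℕ)) * monomial ((P.p 0 - 1 - (a.2 : ℕ) : ℕ) : ℤ) 1 else 0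

theorem J1_mul_colMat : constMat F (P.J1 F) * colMat F P = 1 := by
  ext1 i j
  rw [Matrix.mul_apply, Finset.sum_eq_single (P.lastBox i)]
  · have h1 : constMat F (P.J1 F) i (P.lastBox i) = 1 := by
      rw [constMat_eq, Matrix.map_apply, J1, Matrix.of_apply, if_pos rfl, map_one]
    rw [h1, one_mul, Matrix.one_apply]
    by_cases hij : i = j
    · subst hij
      simp [colMat, lastBox, i.2, monomial_zero_one]
    · have : ¬ (P.lastBox i).1 = j.1 := fun h => hij (Subtype.ext h)
      rw [colMat, Matrix.of_apply, if_neg this, if_neg hij]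
  · intro a _ ha
    rw [constMat_eq, Matrix.map_apply, J1, Matrix.of_apply, if_neg ha, map_zero, zero_mul]
  · simp

theorem del_nil_mul_colMat : (Matrix.diagonal (fun _ => del) + constMat F (P.nil F)) * colMat F P =
    constMat F (P.I1 F) * Matrix.diagonal (fun _ : P.TopRow => topOp F P) := by
  have hcomm : ∀ (k : ℕ) (l : ℤ), (del : PsiDO F) * ((-1) ^ k * monomial l 1) =
      (-1) ^ k * monomial (1 + l) 1 := by
    intro k l
    rw [← mul_assoc, ((Commute.neg_one_right del).pow_right k).eq, mul_assoc, del_eq,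
      monomial_mul_monomial_one]
  ext1 a i
  obtain ⟨j, h⟩ := a
  rw [Matrix.add_mul, Matrix.add_apply, Matrix.diagonal_mul, Matrix.mul_diagonal, Matrix.mul_apply]
  by_cases hij : j = i.1
  · have hp : P.p j = P.p 0 := hij ▸ i.2
    have hlt := h.isLt
    rw [colMat, Matrix.of_apply, if_pos hij, hcomm]
    rcases Nat.eq_zero_or_pos (h : ℕ) with h0 | h0
    · rw [Finset.sum_eq_zero, add_zero]
      · have h1 : constMat F (P.I1 F) ⟨j, h⟩ i = 1 := by
          have : (⟨j, h⟩ : P.Box) = P.firstBox i := by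
            subst hij
            exact congrArg (Sigma.mk i.1) (Fin.ext h0)
          rw [constMat_eq, Matrix.map_apply, I1, Matrix.of_apply, if_pos this, map_one]
        have := P.p_pos 0
        rw [h1, one_mul, h0, Nat.sub_zero, show (1 + ((P.p 0 - 1 : ℕ) : ℤ)) = P.p 0 by lia]
      · intro c _
        have : P.nil F ⟨j, h⟩ c = 0 := by
          simp only [nil, Matrix.of_apply, ite_eq_right_iff]
          intro hc
          lia
        rw [constMat_eq, Matrix.map_apply, this, map_zero, zero_mul]
    · have h1 : constMat F (P.I1 F) ⟨j, h⟩ i = 0 := by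
        have : (⟨j, h⟩ : P.Box) ≠ P.firstBox i := by
          intro hc
          subst hij
          have h2 : h = ⟨0, P.p_pos i.1⟩ := eq_of_heq (Sigma.mk.inj hc).2
          rw [h2] at h0
          exact lt_irrefl _ h0
        rw [constMat_eq, Matrix.map_apply, I1, Matrix.of_apply, if_neg this, map_zero]
      rw [h1, zero_mul, Finset.sum_eq_single (⟨j, ⟨h - 1, by lia⟩⟩ : P.Box)]
      · have : P.nil F ⟨j, h⟩ ⟨j, ⟨h - 1, by lia⟩⟩ = 1 := by
          simp only [nil, Matrix.of_apply, ite_eq_left_iff]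
          intro hc
          exact absurd ⟨trivial, by lia⟩ hc
        rw [constMat_eq, Matrix.map_apply, this, map_one, one_mul, Matrix.of_apply, if_pos hij]
        simp only
        obtain ⟨k, hk⟩ : ∃ k : ℕ, P.p 0 - 1 - (h : ℕ) = k := ⟨_, rfl⟩
        rw [hk, show P.p 0 - 1 - ((h : ℕ) - 1) = k + 1 by lia, pow_succ]
        push_cast
        rw [add_comm (1 : ℤ)]
        noncomm_ring
      · rintro ⟨c, k⟩ _ hc
        have : P.nil F ⟨j, h⟩ ⟨c, k⟩ = 0 := by
          simp only [nil, Matrix.of_apply, ite_eq_right_iff]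
          rintro ⟨rfl, h2⟩
          exact absurd (congrArg (Sigma.mk j) (Fin.ext (by simp only; lia))) hc
        rw [constMat_eq, Matrix.map_apply, this, map_zero, zero_mul]
      · simp
  · have h1 : constMat F (P.I1 F) ⟨j, h⟩ i = 0 := by
      have : (⟨j, h⟩ : P.Box) ≠ P.firstBox i := fun hc => hij (congrArg Sigma.fst hc)
      rw [constMat_eq, Matrix.map_apply, I1, Matrix.of_apply, if_neg this, map_zero]
    rw [h1, zero_mul, colMat, Matrix.of_apply, if_neg hij, mul_zero, zero_add]
    refine Finset.sum_eq_zero fun c _ => ?_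
    by_cases hc : c.1 = i.1
    · have : P.nil F ⟨j, h⟩ c = 0 := by
        simp only [nil, Matrix.of_apply, ite_eq_right_iff]
        rintro ⟨h2, -⟩
        exact absurd (h2.trans hc) hij
      rw [constMat_eq, Matrix.map_apply, this, map_zero, zero_mul]
    · rw [Matrix.of_apply, if_neg hc, mul_zero]

/-- Under the specialization, `L₁(∂)` becomes `-(-∂)^{p₁} + W`. -/
theorem specPsi_inverse_L1_mul :
    (specPsi hF W).mapMatrix (Ring.inverse (P.L1 F)) *
      (Matrix.diagonal (fun _ : P.TopRow => topOp F P) + constMat F W) = 1 := by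
  set B := (specPsi hF W).mapMatrix (Ring.inverse (P.rhoA F)) with hB
  have h1 : (specPsi hF W).mapMatrix (Ring.inverse (P.L1 F)) =
      constMat F (P.J1 F) * B * constMat F (P.I1 F) := by
    rw [J1_mul_mul_I1, inverse_L1]
    rfl
  have h2 : (specPsi hF W).mapMatrix (P.rhoA F) * colMat F P =
      constMat F (P.I1 F) * (Matrix.diagonal (fun _ : P.TopRow => topOp F P) + constMat F W) := by
    rw [specPsi_rhoA, constMat_add, ← add_assoc, Matrix.add_mul, del_nil_mul_colMat, Matrix.mul_add,
      cornerMat, constMat_mul, constMat_mul, Matrix.mul_assoc _ (constMat F (P.J1 F)),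
      J1_mul_colMat, Matrix.mul_one]
  have h3 : B * (specPsi hF W).mapMatrix (P.rhoA F) = 1 := by
    rw [hB, ← map_mul, Ring.inverse_mul_cancel _ isUnit_rhoA, map_one]
  rw [h1, Matrix.mul_assoc, ← h2, Matrix.mul_assoc, ← Matrix.mul_assoc B, h3, Matrix.one_mul,
    J1_mul_colMat]

end Specialization

end Pyramid

/-! ### Polynomials in `±∂ᵏ` -/

namespace PsiDO

section Pencil

variable {F : Type*} [Field F] [Differential F] {m s : Type*} [Fintype m] [DecidableEq m]
  [Fintype s] [DecidableEq s]

/-- If `B` inverts `±∂ᵏ + W` and `J W⁻¹ I` is invertible, then so is `J B I`: multiplied by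
`det (t + W)` at `t = ±∂ᵏ`, it is the value of `J adj(t + W) I`, whose determinant does not vanish
at `t = 0`. -/
theorem isUnit_mul_mul_of_mul_pencil (hF : ∀ c : F, c′ = 0) (j : ℕ) {k : ℕ} (hk : 0 < k)
    {Z W : Matrix m m F} (hZW : Z * W = 1) {I : Matrix m s F} {J : Matrix s m F}
    (h : IsUnit (J * Z * I)) {B : Matrix m m (PsiDO F)}
    (hB : B * (Matrix.diagonal (fun _ : m => (-1) ^ j * monomial (k : ℤ) 1) +
      W.map (constHom F)) = 1) :
    IsUnit (J.map (constHom F) * B * I.map (constHom F)) := by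
  set θ := evalMonomial hF j k
  have hθW : W.map (constHom F) = (W.map Polynomial.C).map θ := by
    ext1 x y
    exact (evalMonomial_C hF j (W x y)).symm
  have hθJ : J.map (constHom F) = (J.map Polynomial.C).map θ := by
    ext1 x y
    exact (evalMonomial_C hF j (J x y)).symm
  have hθI : I.map (constHom F) = (I.map Polynomial.C).map θ := by
    ext1 x y
    exact (evalMonomial_C hF j (I x y)).symm
  let T : Matrix m m F[X] := Matrix.diagonal (fun _ => Polynomial.X) + W.map Polynomial.C
  let N : Matrix s s F[X] := J.map Polynomial.C * T.adjugate * I.map Polynomial.C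
  have hT : θ.mapMatrix T = Matrix.diagonal (fun _ : m => (-1) ^ j * monomial (k : ℤ) 1) +
      W.map (constHom F) := by
    rw [hθW, map_add]
    congr 1
    rw [RingHom.mapMatrix_apply, Matrix.diagonal_map (map_zero θ)]
    simp only [θ, evalMonomial_X]
  have hT0 : (Polynomial.evalRingHom (0 : F)).mapMatrix T = W := by
    ext a b
    change Polynomial.eval 0
      (Matrix.diagonal (fun _ => Polynomial.X) a b + Polynomial.C (W a b)) = _
    rw [Matrix.diagonal_apply]
    split_ifs <;> simp
  have hW : W.det ≠ 0 := fun h0 => by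
    have := congrArg Matrix.det hZW
    rw [Matrix.det_mul, h0, mul_zero, Matrix.det_one] at this
    exact zero_ne_one this
  have hTdet : T.det ≠ 0 := by
    intro h0
    have := congrArg (Polynomial.evalRingHom (0 : F)) h0
    rw [RingHom.map_det, hT0, map_zero] at this
    exact hW this
  have hadj : W.adjugate = W.det • Z := by
    rw [← one_mul W.adjugate, ← hZW, mul_assoc, Matrix.mul_adjugate, Matrix.mul_smul, mul_one]
  have hN : N.det ≠ 0 := by
    intro h0
    have h1 := congrArg (Polynomial.evalRingHom (0 : F)) h0
    have h2 : (Polynomial.evalRingHom (0 : F)).mapMatrix N = W.det • (J * Z * I) := by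
      have hJ : (J.map Polynomial.C).map (Polynomial.evalRingHom (0 : F)) = J := by ext; simp
      have hI : (I.map Polynomial.C).map (Polynomial.evalRingHom (0 : F)) = I := by ext; simp
      rw [RingHom.mapMatrix_apply, Matrix.map_mul, Matrix.map_mul, hJ, hI,
        ← RingHom.mapMatrix_apply, RingHom.map_adjugate, hT0, hadj, Matrix.mul_smul,
        Matrix.smul_mul]
    rw [RingHom.map_det, h2, Matrix.det_smul, map_zero] at h1
    exact mul_ne_zero (pow_ne_zero _ hW) ((Matrix.isUnit_iff_isUnit_det _).mp h).ne_zero h1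
  have h1 : B * θ.mapMatrix (Matrix.scalar m T.det) = θ.mapMatrix T.adjugate := by
    rw [Matrix.scalar_apply, ← Matrix.smul_one_eq_diagonal, ← Matrix.mul_adjugate, map_mul, hT,
      ← mul_assoc, hB, one_mul]
  have h2 : Matrix.scalar m T.det * I.map Polynomial.C =
      I.map Polynomial.C * Matrix.scalar s T.det := by
    ext1 a b
    rw [Matrix.scalar_apply, Matrix.scalar_apply, Matrix.diagonal_mul, Matrix.mul_diagonal,
      mul_comm]
  have h3 : J.map (constHom F) * B * I.map (constHom F) * θ.mapMatrix (Matrix.scalar s T.det) =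
      θ.mapMatrix N := by
    rw [Matrix.mul_assoc, hθI, RingHom.mapMatrix_apply, ← Matrix.map_mul, ← h2, Matrix.map_mul,
      Matrix.mul_assoc, ← Matrix.mul_assoc B, ← RingHom.mapMatrix_apply, h1, hθJ,
      RingHom.mapMatrix_apply, RingHom.mapMatrix_apply, Matrix.map_mul, Matrix.map_mul,
      Matrix.mul_assoc]
  have h4 : IsUnit (θ.mapMatrix (Matrix.scalar s T.det)) := by
    refine isUnit_mapMatrix_evalMonomial hF j hk ?_
    rw [Matrix.scalar_apply, Matrix.det_diagonal, Finset.prod_const]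
    exact pow_ne_zero _ hTdet
  rw [← h4.mul_right_iff, h3]
  exact isUnit_mapMatrix_evalMonomial hF j hk hN

end Pencil

end PsiDO

/-! ### Differential subfields -/

section Subfield

variable {K : Type*} [Field K] [Differential K]

theorem Subfield.deriv_mem_closure {s : Set K} (hs : ∀ x ∈ s, x′ ∈ closure s) {x : K}
    (hx : x ∈ closure s) : x′ ∈ closure s := by
  induction hx using Subfield.closure_induction with
  | mem x hx => exact hs x hx
  | one => rw [Derivation.map_one_eq_zero]; exact zero_mem _
  | add x y _ _ hx hy => rw [map_add]; exact add_mem hx hy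
  | neg x _ hx => rw [map_neg]; exact neg_mem hx
  | inv x hx h =>
    rw [Derivation.leibniz_inv, smul_eq_mul]
    exact mul_mem (neg_mem (pow_mem (inv_mem hx) 2)) h
  | mul x y hx hy h h' =>
    rw [Derivation.leibniz, smul_eq_mul, smul_eq_mul]
    exact add_mem (mul_mem hx h') (mul_mem hy h)

/-- The restriction of the derivation to a subfield which it preserves. -/
abbrev Subfield.differential (k : Subfield K) (hk : ∀ x ∈ k, x′ ∈ k) : Differential k :=
  differentialOfLeibniz
    { toFun := fun x => ⟨(x : K)′, hk x x.2⟩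
      map_zero' := Subtype.ext (map_zero _)
      map_add' := fun _ _ => Subtype.ext (map_add _ _ _) }
    fun _ _ => Subtype.ext (Derivation.leibniz _ _ _)

/-- If the coefficients of an invertible matrix of operators lie in a differential subfield, so do
those of its inverse. -/
theorem PsiDO.coeff_inverse_mem {k : Subfield K} (hk : ∀ x ∈ k, x′ ∈ k) {s : Type*} [Fintype s]
    [DecidableEq s] {M : Matrix s s (PsiDO K)} (hM : IsUnit M) (h : ∀ i j n, (M i j).coeff n ∈ k)
    (i j : s) (n : ℤ) : (Ring.inverse M i j).coeff n ∈ k := by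
  let _ := k.differential hk
  let M₀ : Matrix s s (PsiDO k) := Matrix.of fun i j =>
    ⟨fun n => ⟨(M i j).coeff n, h i j n⟩, by
      obtain ⟨N, hN⟩ := (M i j).exists_bound
      exact ⟨N, fun n hn => Subtype.ext (hN n hn)⟩⟩
  let φ := mapHom k.subtype fun _ => rfl
  have hφ : φ.mapMatrix M₀ = M := rfl
  have hM₀ : IsUnit M₀ := isUnit_of_isUnit_map k.subtype (fun _ => rfl) (hφ ▸ hM)
  have h1 : Ring.inverse M = φ.mapMatrix (Ring.inverse M₀) := by
    refine left_inv_eq_right_inv (Ring.inverse_mul_cancel _ hM) ?_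
    rw [← hφ, ← map_mul, Ring.mul_inverse_cancel _ hM₀, map_one]
  rw [h1]
  exact ((Ring.inverse M₀ i j).coeff n).2

end Subfield

namespace Pyramid

open PsiDO

variable {F : Type*} [Field F] {P : Pyramid}

/-! ### The quasideterminant `L(∂)` -/

section Generic

variable {s : Type*}

variable (F P) in
/-- The inclusion of the operators over `𝒱(𝔤_{≤1/2})` in those over its field of fractions. -/
noncomputable def fracPsi : PsiDO (P.VLow F) →+* PsiDO (P.KLow F) :=
  mapHom (algebraMap _ _) fun v => (deriv_algebraMap v).symm

theorem fracPsi_mapMatrix_L1 : (fracPsi F P).mapMatrix (P.L1 F) = P.L1K F := rfl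

theorem fracPsi_mapMatrix_inverse_L1 :
    (fracPsi F P).mapMatrix (Ring.inverse (P.L1 F)) = Ring.inverse (P.L1K F) := by
  refine left_inv_eq_right_inv (a := P.L1K F) ?_ ?_
  · rw [← fracPsi_mapMatrix_L1, ← map_mul, Ring.inverse_mul_cancel _ isUnit_L1, map_one]
  · exact Ring.mul_inverse_cancel _ (isUnit_L1.map (fracPsi F P).mapMatrix)

/-- The matrix `J L₁(∂)⁻¹ I`. -/
noncomputable def invL (I : Matrix P.TopRow s F) (J : Matrix s P.TopRow F) :
    Matrix s s (PsiDO (P.VLow F)) :=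
  constMat (P.VLow F) J * Ring.inverse (P.L1 F) * constMat (P.VLow F) I

/-- `J L₁(∂)⁻¹ I` is defined over `𝒱(𝔤_{≤1/2})`, because `L₁(∂)` is invertible there. -/
theorem fracPsi_invL [Fintype s] [DecidableEq s] (I : Matrix P.TopRow s F)
    (J : Matrix s P.TopRow F) :
    (fracPsi F P).mapMatrix (invL I J) =
      constMat (P.KLow F) J * Ring.inverse (P.L1K F) * constMat (P.KLow F) I := by
  rw [invL, RingHom.mapMatrix_apply, Matrix.map_mul, Matrix.map_mul,
    ← RingHom.mapMatrix_apply (fracPsi F P) (Ring.inverse (P.L1 F)), fracPsi_mapMatrix_inverse_L1]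
  have h : ∀ c : F, algebraMap (P.VLow F) (P.KLow F) (algebraMap F (P.VLow F) c) =
      algebraMap F (P.KLow F) c := fun c => (IsScalarTower.algebraMap_apply F _ _ c).symm
  rw [fracPsi, constMat_map _ _ h, constMat_map _ _ h]

theorem coeff_invL_mem_W [CharZero F] (ε : F) {S : P.Gl F} (hS : S ∈ P.gPart F P.depth)
    (I : Matrix P.TopRow s F) (J : Matrix s P.TopRow F) (i j : s) (n : ℤ) :
    (invL I J i j).coeff n ∈ W ε S := by
  refine (coeff_mem_W_iff ε).mpr (fun m hm => ?_) n
  change invL I J i j ∈ (gaugePsi ε S m).eqLocus (inclPsi F P)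
  have hc : ∀ c : F, const (algebraMap F (P.VLow F) c) ∈
      (gaugePsi ε S m).eqLocus (inclPsi F P) := by
    intro c
    refine (coeff_mem_W_iff ε).mp (fun n => ?_) m hm
    rw [coeff_const]
    split_ifs
    · exact Subalgebra.algebraMap_mem _ c
    · exact Subalgebra.zero_mem _
  rw [invL, Matrix.mul_apply]
  refine sum_mem fun a _ => mul_mem ?_ (hc _)
  rw [Matrix.mul_apply]
  exact sum_mem fun b _ => mul_mem (hc _)
    ((coeff_mem_W_iff ε).mp (coeff_inverse_L1_mem_W ε hS b a) m hm)

/-- The operator `J L₁(∂)⁻¹ I` is invertible over the field of fractions, because a specialization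
of its coefficients to constants is invertible. -/
theorem isUnit_fracPsi_invL [Fintype s] [DecidableEq s] [Infinite F]
    {I : Matrix P.TopRow s F} {J : Matrix s P.TopRow F}
    {L : Matrix s P.TopRow F} {R : Matrix P.TopRow s F} (hL : L * I = 1) (hR : J * R = 1) :
    IsUnit ((fracPsi F P).mapMatrix (invL I J)) := by
  -- the constants carry the zero derivation
  let _ : Differential F := ⟨0⟩
  have hF : ∀ c : F, c′ = 0 := fun _ => rfl
  obtain ⟨Z, hZ, hJZI⟩ := exists_isUnit_mul_mul hL hR
  obtain ⟨W, hZW⟩ := hZ.exists_right_inv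
  have hunit : IsUnit ((specPsi hF W).mapMatrix (invL I J)) := by
    have hs : ∀ c : F, (spec W).toRingHom (algebraMap F (P.VLow F) c) = algebraMap F F c :=
      (spec W).commutes
    have : (specPsi hF W).mapMatrix (invL I J) = constMat F J *
        (specPsi hF W).mapMatrix (Ring.inverse (P.L1 F)) * constMat F I := by
      rw [invL, RingHom.mapMatrix_apply, Matrix.map_mul, Matrix.map_mul, specPsi,
        constMat_map _ _ hs, constMat_map _ _ hs, RingHom.mapMatrix_apply]
    rw [this]
    exact isUnit_mul_mul_of_mul_pencil hF (P.p 0 - 1) (P.p_pos 0) hZW hJZI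
      (specPsi_inverse_L1_mul hF W)
  obtain ⟨U, hU⟩ := hunit.exists_right_inv
  -- lift the inverse `U` of the specialization to an operator over `𝒱(𝔤_{≤1/2})`
  let lift : PsiDO F →+* PsiDO (P.VLow F) := mapHom (algebraMap F (P.VLow F)) fun c => by
    rw [hF, map_zero, deriv_algebraMap_vLow]
  have hlift : (specPsi hF W).mapMatrix (lift.mapMatrix U) = U := by
    ext i j n
    exact (spec W).commutes _
  have h1 : (specPsi hF W).mapMatrix (invL I J * lift.mapMatrix U) = 1 := by
    rw [map_mul, hlift, hU]
  have h2 := isUnit_map_of_map_eq_one (algebraMap (P.VLow F) (P.KLow F))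
    (IsFractionRing.injective _ _) (fun v => (deriv_algebraMap v).symm) (spec W).toRingHom
    (spec_deriv hF W) h1
  change IsUnit ((fracPsi F P).mapMatrix _) at h2
  rw [map_mul] at h2
  obtain ⟨V, hV⟩ := h2.exists_right_inv
  refine isUnit_matrix_of_vecMul_eq_zero fun v hv => ?_
  have h3 := congrArg (fun w => Matrix.vecMul w ((fracPsi F P).mapMatrix (lift.mapMatrix U) * V)) hv
  simp only [Matrix.vecMul_vecMul, Matrix.zero_vecMul] at h3
  rwa [← mul_assoc, hV, Matrix.vecMul_one] at h3

end Generic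

theorem deriv_mem_fracW {ε : F} {S : P.Gl F} (x : P.KLow F) (hx : x ∈ fracW ε S) :
    x′ ∈ fracW ε S := by
  refine Subfield.deriv_mem_closure ?_ hx
  rintro _ ⟨w, hw, rfl⟩
  rw [deriv_algebraMap]
  exact Subfield.subset_closure ⟨_, deriv_mem_W hw, rfl⟩

theorem quasidetExists_L1K {s : Type*} [Fintype s] [DecidableEq s] [Infinite F]
    {I : Matrix P.TopRow s F} {J : Matrix s P.TopRow F}
    {L : Matrix s P.TopRow F} {R : Matrix P.TopRow s F} (hL : L * I = 1) (hR : J * R = 1) :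
    QuasidetExists (P.L1K F) (constMat (P.KLow F) I) (constMat (P.KLow F) J) := by
  refine ⟨isUnit_L1.map (fracPsi F P).mapMatrix, ?_⟩
  rw [← fracPsi_invL]
  exact isUnit_fracPsi_invL hL hR

theorem coeff_fracPsi_invL_mem_fracW [CharZero F] (ε : F) {S : P.Gl F} (hS : S ∈ P.gPart F P.depth)
    {s : Type*} [Fintype s] [DecidableEq s] (I : Matrix P.TopRow s F) (J : Matrix s P.TopRow F)
    (i j : s) (n : ℤ) : ((fracPsi F P).mapMatrix (invL I J) i j).coeff n ∈ fracW ε S := by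
  refine Subfield.subset_closure ⟨(invL I J i j).coeff n, coeff_invL_mem_W ε hS I J i j n, ?_⟩
  rfl

theorem coeff_quasidet_L1K_mem_fracW [CharZero F] (ε : F) {S : P.Gl F}
    (hS : S ∈ P.gPart F P.depth) {s : Type*} [Fintype s] [DecidableEq s]
    {I : Matrix P.TopRow s F} {J : Matrix s P.TopRow F}
    {L : Matrix s P.TopRow F} {R : Matrix P.TopRow s F} (hL : L * I = 1) (hR : J * R = 1)
    (i j : s) (n : ℤ) :
    (quasidet (P.L1K F) (constMat (P.KLow F) I) (constMat (P.KLow F) J) i j).coeff n ∈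
      fracW ε S := by
  rw [quasidet, ← fracPsi_invL]
  exact coeff_inverse_mem (k := fracW ε S) deriv_mem_fracW (isUnit_fracPsi_invL hL hR)
    (coeff_fracPsi_invL_mem_fracW ε hS I J) i j n

end Pyramid

theorem mainTheorem4 (F : Type*) [Field F] [CharZero F] (P : Pyramid)
    (ε : F) (S : P.Gl F) (hS : S ∈ P.gPart F P.depth) :
    (QuasidetExists (P.rhoA F) (Pyramid.constMat _ (P.I1 F)) (Pyramid.constMat _ (P.J1 F)) ∧
      ∀ i j n, (P.L1 F i j).coeff n ∈ Pyramid.W ε S) ∧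
    (S ≠ 0 → ∀ (s : ℕ) (I : Matrix P.TopRow (Fin s) F) (J : Matrix (Fin s) P.TopRow F),
      IsCanonicalFactorization (Pyramid.barS S) I J →
        QuasidetExists (P.L1K F) (Pyramid.constMat _ I) (Pyramid.constMat _ J) ∧
        ∀ i j n, (quasidet (P.L1K F) (Pyramid.constMat _ I) (Pyramid.constMat _ J) i j).coeff n ∈
          Pyramid.fracW ε S) := by
  refine ⟨⟨Pyramid.quasidetExists_rhoA, Pyramid.coeff_L1_mem_W ε hS⟩,
    fun _ s I J hIJ => ?_⟩
  obtain ⟨⟨L, hL⟩, R, hR⟩ := hIJ.exists_inverses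
  exact ⟨Pyramid.quasidetExists_L1K hL hR, Pyramid.coeff_quasidet_L1K_mem_fracW ε hS hL hR⟩
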